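/- Let $\phi(x)=(2\pi)^{-1/2}e^{-x^2/2}$, let $h_n(x)=(-1)^n e^{x^2/2}\frac{d^n}{dx^n}e^{-x^2/2}$ be the Hermite polynomials and $\widehat h_n=(n!)^{-1/2}h_n$. Fix $0<q<1$ and let $\mathcal H_q$ be the Hilbert space of all functions $f\colon\mathbb R\to\mathbb C$ of the form $f(x)=\sum_{n\ge 0}a_n\widehat h_n(x)$ with $\|f\|^2:=\sum_{n\ge 0}|a_n|^2q^{-n}<\infty$. For real $\rho$ with $|\rho|$ small, let $T_\rho$ be the bounded operator on $\mathcal H_q$ given by $T_\rho f(x)=\int_{-\rho x}^\infty f(y)\phi(y)\,dy$, let $\lambda_\rho$ be its spectral radius (which is its leading eigenvalue), and put, for $n\ge 0$, $$T^{(n)}f(x)=(-1)^n x^n\frac1{n!}\int_0^\infty (f\phi)^{(n)}(y)\,dy .$$ Theorem. There are $r>0$, real numbers $K_n$ ($n\ge 0$) and functions $g_m\in\mathcal H_q$ ($m\ge 0$) such that for all $|\rho|<r$ we have $\lambda_\rho=\sum_{n\ge 0}\rho^nK_n$, and $f_\rho=\sum_{m\ge 0}\rho^m g_m$ (with convergence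 in $\mathcal H_q$) is an eigenfunction of $T_\rho$ for the eigenvalue $\lambda_\rho$ with $f_\rho(0)=1$. In every expansion $\lambda_\rho=\sum_n\rho^nK_n$, $f_\rho=\sum_m\rho^m g_m$ of $\lambda_\rho$ and of corresponding eigenfunctions $f_\rho\neq 0$, valid for all $\rho$ in a neighbourhood of $0$ (whatever the normalization of the eigenfunctions), $g_m$ is a polynomial of degree at most $m$, for every $m\ge 0$. Sequences $(K_n)$, $(g_m)$, with $K_n\in\mathbb R$ and $g_m\in\mathcal H_q$, are the coefficients of such an expansion with $f_\rho(0)=1$ if and only if $g_0=1$, $K_0=\frac12$, $g_m(0)=0$ for $m\ge 1$, $$g_m=\frac1{K_0}\Big(\sum_{j=1}^m T^{(j)}g_{m-j}-\sum_{j=1}^{m-1}T^{(0)}g_j\cdot g_{m-j}\Big),\quad m\ge 1,$$ and $K_n=T^{(0)}g_n$ for $n\ge 1$. The first coefficients of $\lambda_\rho=\sum_n\rho^nK_n$ are \begin{align*} K_0&=\tfrac12,\qquad K_1=\tfrac1\pi,\qquad K_2=-\tfrac{2}{\pi^2},\qquad K_3=-\tfrac{5}{6\pi}+\tfrac{8}{\pi^3},\qquad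 K_4=\tfrac{13}{3\pi^2}-\tfrac{40}{\pi^4},\\ K_5&=\tfrac{23}{40\pi}-\tfrac{28}{\pi^3}+\tfrac{224}{\pi^5},\qquad K_6=-\tfrac{1069}{180\pi^2}+\tfrac{580}{3\pi^4}-\tfrac{1344}{\pi^6},\\ K_7&=-\tfrac{37}{112\pi}+\tfrac{842}{15\pi^3}-\tfrac{4144}{3\pi^5}+\tfrac{8448}{\pi^7},\qquad K_8=\tfrac{943}{168\pi^2}-\tfrac{1535}{3\pi^4}+\tfrac{10080}{\pi^6}-\tfrac{54912}{\pi^8}. \end{align*} -/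

import Mathlib

open MeasureTheory ProbabilityTheory

namespace MAPersistence

noncomputable section

/-- The standard normal density `φ`. -/
def phi (x : ℝ) : ℝ := gaussianPDFReal 0 1 x

/-- The normalized (probabilists') Hermite polynomial `ĥ_n = h_n / √(n!)` as a function on `ℝ`. -/
def hermiteHat (n : ℕ) (x : ℝ) : ℝ :=
  Polynomial.aeval x (Polynomial.hermite n) / Real.sqrt (n.factorial : ℝ)

/-- `a` is a sequence of Hermite coefficients of `f`, of finite `ℋ_q`-norm:
`∑ |a_n|² q⁻ⁿ < ∞` and `f(x) = ∑ a_n ĥ_n(x)` for every `x`. -/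
def IsCoeff (q : ℝ) (a : ℕ → ℂ) (f : ℝ → ℂ) : Prop :=
  Summable (fun n => ‖a n‖ ^ 2 * (q ^ n)⁻¹) ∧
    ∀ x : ℝ, HasSum (fun n => a n * (hermiteHat n x : ℂ)) (f x)

/-! ### Orthonormality of the Hermite polynomials, and uniqueness of the coefficients -/

/-- The Hermite polynomial with real coefficients. -/
def hermR (n : ℕ) : Polynomial ℝ := (Polynomial.hermite n).map (Int.castRingHom ℝ)

lemma hermiteHat_eq (n : ℕ) (x : ℝ) :
    hermiteHat n x = (hermR n).eval x / Real.sqrt (n.factorial : ℝ) := by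
  simp [hermiteHat, hermR, Polynomial.eval_map, Polynomial.aeval_def]

lemma hermR_succ (n : ℕ) :
    hermR (n + 1) = Polynomial.X * hermR n - Polynomial.derivative (hermR n) := by
  simp [hermR, Polynomial.hermite_succ, Polynomial.derivative_map]

lemma memLp_pow (n : ℕ) : ∀ r : ENNReal, r ≠ ⊤ →
    MemLp (fun x : ℝ => x ^ n) r (gaussianReal 0 1) := by
  induction n with
  | zero => intro r _; simpa using memLp_const (1 : ℝ)
  | succ n ih =>
    intro r hr
    have h2 : (2 * r : ENNReal) ≠ ⊤ := ENNReal.mul_ne_top (by simp) hr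
    have : ENNReal.HolderTriple (2 * r) (2 * r) r := by
      refine ⟨?_⟩
      rw [← two_mul, ENNReal.mul_inv (by simp) (by simp), ← mul_assoc,
        ENNReal.mul_inv_cancel (by simp) (by simp), one_mul]
    have h := (memLp_id_gaussianReal' (μ := 0) (v := 1) (2 * r) h2).mul (ih (2 * r) h2) (r := r)
    refine h.ae_eq (Filter.Eventually.of_forall fun x => ?_)
    simp [pow_succ]

lemma memLp_eval (p : Polynomial ℝ) (r : ENNReal) (hr : r ≠ ⊤) :
    MemLp (fun x => p.eval x) r (gaussianReal 0 1) := by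
  induction p using Polynomial.induction_on' with
  | add p q hp hq =>
    refine (hp.add hq).ae_eq (Filter.Eventually.of_forall fun x => ?_)
    simp
  | monomial n a => simpa using (memLp_pow n r hr).const_mul a

lemma integrable_eval (p : Polynomial ℝ) :
    Integrable (fun x => p.eval x) (gaussianReal 0 1) :=
  (memLp_eval p 1 (by simp)).integrable le_rfl

lemma integrable_pdf_mul_eval (p : Polynomial ℝ) :
    Integrable (fun x => gaussianPDFReal 0 1 x * p.eval x) := by
  have h := integrable_eval p
  rw [gaussianReal_of_var_ne_zero _ one_ne_zero,
    integrable_withDensity_iff_integrable_smul' (measurable_gaussianPDF _ _)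
      (Filter.Eventually.of_forall fun x => by simp [gaussianPDF])] at h
  simpa [toReal_gaussianPDF] using h

lemma hasDerivAt_pdf (x : ℝ) :
    HasDerivAt (gaussianPDFReal 0 1) (-x * gaussianPDFReal 0 1 x) x := by
  rw [gaussianPDFReal_def]
  have h : HasDerivAt (fun x : ℝ => -(x - 0) ^ 2 / (2 * ((1 : NNReal) : ℝ))) (-x) x := by
    have := (((hasDerivAt_id x).sub_const 0).pow 2).neg.div_const (2 * ((1 : NNReal) : ℝ))
    refine this.congr_deriv ?_
    simp only [id, NNReal.coe_one]
    norm_num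
    ring
  have h2 := (h.exp).const_mul (Real.sqrt (2 * Real.pi * ((1 : NNReal) : ℝ)))⁻¹
  refine h2.congr_deriv ?_
  ring

lemma integral_stein (p : Polynomial ℝ) :
    ∫ x, (Polynomial.X * p).eval x ∂(gaussianReal 0 1)
      = ∫ x, (Polynomial.derivative p).eval x ∂(gaussianReal 0 1) := by
  have h0 : ∫ x, gaussianPDFReal 0 1 x *
      (Polynomial.derivative p - Polynomial.X * p).eval x = 0 := by
    refine integral_eq_zero_of_hasDerivAt_of_integrable
      (f := fun x => gaussianPDFReal 0 1 x * p.eval x) (fun x => ?_)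
      (integrable_pdf_mul_eval _) (integrable_pdf_mul_eval _)
    refine ((hasDerivAt_pdf x).mul (p.hasDerivAt x)).congr_deriv ?_
    simp
    ring
  have h1 : ∫ x, (Polynomial.derivative p - Polynomial.X * p).eval x ∂(gaussianReal 0 1) = 0 := by
    rw [integral_gaussianReal_eq_integral_smul one_ne_zero]
    simpa using h0
  simp only [Polynomial.eval_sub] at h1
  rw [integral_sub (integrable_eval _) (integrable_eval _)] at h1
  linarith

lemma integral_mul_hermR (n : ℕ) (p : Polynomial ℝ) :
    ∫ x, (p * hermR n).eval x ∂(gaussianReal 0 1)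
      = ∫ x, (Polynomial.derivative^[n] p).eval x ∂(gaussianReal 0 1) := by
  induction n generalizing p with
  | zero => simp [hermR]
  | succ n ih =>
    have hI : ∀ r : Polynomial ℝ, Integrable (fun x => r.eval x) (gaussianReal 0 1) :=
      fun r => (memLp_eval r 1 (by simp)).integrable le_rfl
    have h1 : p * hermR (n + 1)
        = Polynomial.X * (p * hermR n) - p * Polynomial.derivative (hermR n) := by
      rw [hermR_succ]; ring
    rw [Function.iterate_succ_apply, ← ih, h1]
    simp only [Polynomial.eval_sub]
    rw [integral_sub (hI _) (hI _), integral_stein, ← integral_sub (hI _) (hI _)]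
    congr 1
    ext x
    simp [Polynomial.derivative_mul]

lemma integral_hermR_lt {m n : ℕ} (h : m < n) :
    ∫ x, (hermR m * hermR n).eval x ∂(gaussianReal 0 1) = 0 := by
  rw [integral_mul_hermR, Polynomial.iterate_derivative_eq_zero]
  · simp
  · refine lt_of_le_of_lt Polynomial.natDegree_map_le ?_
    simpa [Polynomial.natDegree_hermite] using h

lemma integral_hermR_self (n : ℕ) :
    ∫ x, (hermR n * hermR n).eval x ∂(gaussianReal 0 1) = n.factorial := by
  rw [integral_mul_hermR]
  have hd : (Polynomial.derivative^[n] (hermR n)).natDegree ≤ 0 := by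
    refine (Polynomial.natDegree_iterate_derivative _ _).trans ?_
    have : (hermR n).natDegree ≤ n := Polynomial.natDegree_map_le.trans (by simp)
    omega
  rw [Polynomial.eq_C_of_natDegree_le_zero hd, Polynomial.coeff_iterate_derivative]
  simp [hermR, Nat.descFactorial_self]

lemma integral_hermiteHat (m n : ℕ) :
    ∫ x, hermiteHat m x * hermiteHat n x ∂(gaussianReal 0 1) = if m = n then 1 else 0 := by
  have h1 : ∀ x, hermiteHat m x * hermiteHat n x = (hermR m * hermR n).eval x *
      (Real.sqrt (m.factorial : ℝ) * Real.sqrt (n.factorial : ℝ))⁻¹ := by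
    intro x
    rw [hermiteHat_eq, hermiteHat_eq, Polynomial.eval_mul]
    field_simp
  simp only [h1]
  rw [integral_mul_const]
  rcases lt_trichotomy m n with h | h | h
  · rw [integral_hermR_lt h]; simp [h.ne]
  · subst h
    rw [integral_hermR_self, Real.mul_self_sqrt (by positivity)]
    simp [Nat.factorial_ne_zero]
  · rw [mul_comm (hermR m), integral_hermR_lt h]; simp [h.ne']

lemma memLp_hermiteHat (n : ℕ) :
    MemLp (fun x => (hermiteHat n x : ℂ)) 2 (gaussianReal 0 1) := by
  have h := ((memLp_eval (hermR n) 2 (by simp)).mul_const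
    (Real.sqrt (n.factorial : ℝ))⁻¹).ofReal (K := ℂ)
  refine h.ae_eq (Filter.Eventually.of_forall fun x => ?_)
  simp [hermiteHat_eq, div_eq_mul_inv]

/-- `ĥ_n` as an element of `L²(γ)`. -/
def hermLp (n : ℕ) : Lp ℂ 2 (gaussianReal 0 1) := (memLp_hermiteHat n).toLp

lemma orthonormal_hermLp : Orthonormal ℂ hermLp := by
  rw [orthonormal_iff_ite]
  intro m n
  rw [L2.inner_def]
  have h : ∫ x, inner ℂ (hermLp m x) (hermLp n x) ∂(gaussianReal 0 1)
      = ∫ x, ((hermiteHat m x * hermiteHat n x : ℝ) : ℂ) ∂(gaussianReal 0 1) := by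
    refine integral_congr_ae ?_
    filter_upwards [(memLp_hermiteHat m).coeFn_toLp, (memLp_hermiteHat n).coeFn_toLp]
      with x hm hn
    rw [hermLp, hermLp, hm, hn]
    simp [mul_comm]
  rw [h, integral_complex_ofReal, integral_hermiteHat]
  split_ifs <;> simp

lemma coeff_eq_zero {a : ℕ → ℂ} (ha : Summable (fun n => ‖a n‖ ^ 2))
    (h : ∀ x : ℝ, HasSum (fun n => a n * (hermiteHat n x : ℂ)) 0) : a = 0 := by
  have hmem : Memℓp a 2 := by
    refine memℓp_gen ?_
    simp only [ENNReal.toReal_ofNat, Real.rpow_ofNat]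
    exact ha
  have hs := orthonormal_hermLp.orthogonalFamily.hasSum_linearIsometry ⟨a, hmem⟩
  set F := orthonormal_hermLp.orthogonalFamily.linearIsometry ⟨a, hmem⟩ with hF
  replace hs : HasSum (fun n => a n • hermLp n) F := by simpa using hs
  have hcoe : ∀ N, ∀ᵐ x ∂(gaussianReal 0 1),
      (∑ n ∈ Finset.range N, a n • hermLp n : Lp ℂ 2 (gaussianReal 0 1)) x
        = ∑ n ∈ Finset.range N, a n * (hermiteHat n x : ℂ) := by
    intro N
    induction N with
    | zero =>
      filter_upwards [Lp.coeFn_zero ℂ 2 (gaussianReal 0 1)] with x hx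
      simpa using hx
    | succ N ih =>
      rw [Finset.sum_range_succ]
      filter_upwards [ih, Lp.coeFn_add (∑ n ∈ Finset.range N, a n • hermLp n) (a N • hermLp N),
        Lp.coeFn_smul (a N) (hermLp N), (memLp_hermiteHat N).coeFn_toLp] with x h1 h2 h3 h4
      rw [h2, Pi.add_apply, h1, h3, Pi.smul_apply, Finset.sum_range_succ, hermLp, h4, smul_eq_mul]
  obtain ⟨ns, hns, hlim⟩ :=
    (tendstoInMeasure_of_tendsto_Lp hs.tendsto_sum_nat).exists_seq_tendsto_ae
  have hF0 : F = 0 := by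
    rw [Lp.eq_zero_iff_ae_eq_zero]
    filter_upwards [hlim, ae_all_iff.2 hcoe] with x hx hc
    simp only [hc] at hx
    exact tendsto_nhds_unique hx ((h x).tendsto_sum_nat.comp hns.tendsto_atTop)
  have h0 : (⟨a, hmem⟩ : lp (fun _ : ℕ => ℂ) 2) = 0 := by
    apply orthonormal_hermLp.orthogonalFamily.linearIsometry.injective
    rw [map_zero]
    exact hF0
  exact congrArg (fun f : lp (fun _ : ℕ => ℂ) 2 => (f : ℕ → ℂ)) h0

/-! ### The Hilbert space `ℋ_q`, for `0 < q < 1` -/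

variable {q : Set.Ioo (0 : ℝ) 1}

lemma IsCoeff.add {a b : ℕ → ℂ} {f g : ℝ → ℂ} (ha : IsCoeff q a f) (hb : IsCoeff q b g) :
    IsCoeff q (a + b) (f + g) := by
  have hq := q.2.1
  refine ⟨?_, fun x => by simpa [add_mul] using (ha.2 x).add (hb.2 x)⟩
  refine Summable.of_nonneg_of_le (fun n => by positivity) (fun n => ?_)
    ((ha.1.add hb.1).mul_left 2)
  have h1 : ‖(a + b) n‖ ^ 2 ≤ 2 * (‖a n‖ ^ 2 + ‖b n‖ ^ 2) := by
    have := norm_add_le (a n) (b n)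
    have h0 := norm_nonneg (a n + b n)
    simp only [Pi.add_apply]
    nlinarith [sq_nonneg (‖a n‖ - ‖b n‖)]
  calc _ ≤ 2 * (‖a n‖ ^ 2 + ‖b n‖ ^ 2) * ((q : ℝ) ^ n)⁻¹ := by gcongr
    _ = _ := by ring

lemma IsCoeff.smul {a : ℕ → ℂ} {f : ℝ → ℂ} (c : ℂ) (ha : IsCoeff q a f) :
    IsCoeff q (c • a) (c • f) := by
  refine ⟨?_, fun x => by simpa [mul_assoc] using (ha.2 x).mul_left c⟩
  refine (ha.1.mul_left (‖c‖ ^ 2)).congr fun n => ?_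
  simp only [Pi.smul_apply, smul_eq_mul, norm_mul]
  ring

lemma IsCoeff.unique {a b : ℕ → ℂ} {f : ℝ → ℂ} (ha : IsCoeff q a f) (hb : IsCoeff q b f) :
    a = b := by
  have hq := q.2
  have h := ha.add (hb.smul (-1))
  have h0 : a + (-1 : ℂ) • b = 0 := by
    refine coeff_eq_zero (Summable.of_nonneg_of_le (fun n => by positivity) (fun n => ?_) h.1)
      (fun x => by simpa using h.2 x)
    have : 1 ≤ ((q : ℝ) ^ n)⁻¹ :=
      (one_le_inv₀ (pow_pos hq.1 n)).2 (pow_le_one₀ hq.1.le hq.2.le)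
    nlinarith [sq_nonneg ‖(a + (-1 : ℂ) • b) n‖]
  have h1 : a - b = 0 := by rw [← h0]; simp [sub_eq_add_neg]
  exact sub_eq_zero.1 h1

variable (q) in
/-- The functions in `ℋ_q`, as a subspace of all functions `ℝ → ℂ`. -/
def hqSubmodule : Submodule ℂ (ℝ → ℂ) where
  carrier := {f | ∃ a : ℕ → ℂ, IsCoeff q a f}
  add_mem' := fun ⟨_, ha⟩ ⟨_, hb⟩ => ⟨_, ha.add hb⟩
  zero_mem' := ⟨0, by simp, fun x => by simp⟩
  smul_mem' := fun c _ ⟨_, ha⟩ => ⟨_, ha.smul c⟩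

variable (q) in
/-- The space `ℋ_q` of functions `f : ℝ → ℂ`, `f = ∑ a_n ĥ_n` with `∑ |a_n|² q⁻ⁿ < ∞`. It is not
given the topology of pointwise convergence, hence a type of its own. -/
def Hq : Type := hqSubmodule q

instance : AddCommGroup (Hq q) := inferInstanceAs (AddCommGroup (hqSubmodule q))

instance : Module ℂ (Hq q) := inferInstanceAs (Module ℂ (hqSubmodule q))

/-- An element of `ℋ_q` is a function. -/
instance : FunLike (Hq q) ℝ ℂ where
  coe f := f.1
  coe_injective _ _ h := Subtype.ext h

/-- The Hermite coefficients `a_n` of `f ∈ ℋ_q`. -/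
def Hq.coeff (f : Hq q) : ℕ → ℂ := Classical.choose f.2

lemma Hq.isCoeff (f : Hq q) : IsCoeff q f.coeff f := Classical.choose_spec f.2

/-- The linear injection of `ℋ_q` into `ℓ²(ℕ, ℂ)` that sends `∑ a_n ĥ_n` to the sequence
`a_n q^(-n/2)`. -/
def Hq.toL2 : Hq q →ₗ[ℂ] lp (fun _ : ℕ => ℂ) 2 where
  toFun f := ⟨fun n => f.coeff n * ((Real.sqrt ((q : ℝ) ^ n))⁻¹ : ℝ), by
    have hq := q.2.1
    refine memℓp_gen ?_
    convert f.isCoeff.1 using 2 with n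
    have : Real.sqrt ((q : ℝ) ^ n) ^ 2 = (q : ℝ) ^ n := Real.sq_sqrt (by positivity)
    simp [mul_pow, this]⟩
  map_add' f g := by
    ext n
    have : (f + g).coeff = f.coeff + g.coeff := (f + g).isCoeff.unique (f.isCoeff.add g.isCoeff)
    change _ = f.coeff n * _ + g.coeff n * _
    simp [this, add_mul]
  map_smul' c f := by
    ext n
    have : (c • f).coeff = c • f.coeff := (c • f).isCoeff.unique (f.isCoeff.smul c)
    simp [this, mul_assoc]

lemma Hq.toL2_injective : Function.Injective (Hq.toL2 (q := q)) := by
  have hq := q.2.1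
  intro f g h
  have hc : f.coeff = g.coeff := by
    funext n
    have h1 : f.coeff n * ((Real.sqrt ((q : ℝ) ^ n))⁻¹ : ℝ)
        = g.coeff n * ((Real.sqrt ((q : ℝ) ^ n))⁻¹ : ℝ) :=
      congrArg (fun u : lp (fun _ : ℕ => ℂ) 2 => u n) h
    refine mul_right_cancel₀ ?_ h1
    have : 0 < Real.sqrt ((q : ℝ) ^ n) := Real.sqrt_pos.2 (by positivity)
    exact_mod_cast (inv_pos.2 this).ne'
  refine DFunLike.ext _ _ fun x => ?_
  have h1 := f.isCoeff.2 x
  rw [hc] at h1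
  exact h1.unique (g.isCoeff.2 x)

/-- The norm of `ℋ_q`, that is `‖∑ a_n ĥ_n‖² = ∑ |a_n|² q⁻ⁿ`. -/
instance : NormedAddCommGroup (Hq q) :=
  NormedAddCommGroup.induced (Hq q) (lp (fun _ : ℕ => ℂ) 2) Hq.toL2 Hq.toL2_injective

/-- The inner product of `ℋ_q`, that is the sum of the `a_n b_n q⁻ⁿ`, with complex conjugation of
the coefficients of the first argument (Mathlib's convention). -/
instance : InnerProductSpace ℂ (Hq q) := InnerProductSpace.induced Hq.toL2

/-! ### The operators -/

/-- The function `T_ρ f`, `T_ρ f(x) = ∫_{-ρx}^∞ f(y) φ(y) dy`. -/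
def maOp (ρ : ℝ) (f : ℝ → ℂ) (x : ℝ) : ℂ :=
  ∫ y in Set.Ioi (-(ρ * x)), f y * (phi y : ℂ)

/-- The function `T⁽ⁿ⁾ f`, `T⁽ⁿ⁾ f(x) = (-1)ⁿ xⁿ (1/n!) ∫_0^∞ (f φ)⁽ⁿ⁾(y) dy`. -/
def maOpCoeff (n : ℕ) (f : ℝ → ℂ) (x : ℝ) : ℂ :=
  (-1) ^ n * (x : ℂ) ^ n * (1 / (n.factorial : ℂ)) *
    ∫ y in Set.Ioi (0 : ℝ), iteratedDeriv n (fun t : ℝ => f t * (phi t : ℂ)) y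

/-- `T_ρ` is a bounded operator on `ℋ_q`, `lam = r(T_ρ)` is its spectral radius, and `f ∈ ℋ_q` is an
eigenfunction of `T_ρ` for the eigenvalue `lam`. -/
def IsLeadingEigenpair (ρ lam : ℝ) (f : Hq q) : Prop :=
  ∃ T : Hq q →L[ℂ] Hq q, (∀ (h : Hq q) (x : ℝ), T h x = maOp ρ h x) ∧
    lam = (spectralRadius ℂ T).toReal ∧ f ≠ 0 ∧ T f = (lam : ℂ) • f

/-- For all `ρ` in a neighbourhood of `0`, the series `∑ ρⁿ K_n` converges to the leading eigenvalue
`λ_ρ = r(T_ρ)` of `T_ρ`, and `∑ ρᵐ g_m` converges in `ℋ_q` to an eigenfunction `f_ρ` for it. -/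
def IsExpansion (K : ℕ → ℝ) (g : ℕ → Hq q) : Prop :=
  ∃ r > 0, ∀ ρ : ℝ, |ρ| < r → ∃ (lam : ℝ) (f : Hq q), IsLeadingEigenpair ρ lam f ∧
    HasSum (fun n => ρ ^ n * K n) lam ∧ HasSum (fun m => (ρ : ℂ) ^ m • g m) f

/-- The same with the eigenfunctions normalized by `f_ρ(0) = 1`. -/
def IsNormalizedExpansion (K : ℕ → ℝ) (g : ℕ → Hq q) : Prop :=
  ∃ r > 0, ∀ ρ : ℝ, |ρ| < r → ∃ (lam : ℝ) (f : Hq q), IsLeadingEigenpair ρ lam f ∧ f 0 = 1 ∧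
    HasSum (fun n => ρ ^ n * K n) lam ∧ HasSum (fun m => (ρ : ℂ) ^ m • g m) f

end

end MAPersistence

open MeasureTheory ProbabilityTheory

namespace MAPersistence

noncomputable section

/-! ### Cauchy products and power series of a real variable -/

/-! The starting point is the Taylor expansion of `t ↦ ∫_t^∞ f φ` at `0`, taken at `t = -ρx`. It
gives `T_ρ = ∑ ρⁿ T⁽ⁿ⁾` with rank one terms `T⁽ⁿ⁾ f = A_n(f) xⁿ / n!`. On `ℋ_q` both `‖A_n‖` and
`‖xⁿ‖` are at most `√(n!)` times a geometric factor, and `1/n!` absorbs the two square roots. So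
`‖T⁽ⁿ⁾‖` grows at most geometrically (`norm_coeffOp_le`) and the series converges in operator norm
for small `ρ`. It is identified with `T_ρ` on the Hermite basis, then by continuity
(`apply_eq_maOp_of_hasSum`).

The rest of the perturbation theory is abstract (`RankOnePerturbation`). The unperturbed operator is
`ℓ(·) e` with `ℓ e = 1/2`, and a functional `ev` (evaluation at `0`) kills the ranges of all higher
terms. Applying `ev` to `T f = λ f` with `ev f = 1` gives `λ = ℓ f`, so the eigenvalue equation
becomes the quadratic equation `T f = ℓ(f) f`. Its coefficients of `ρᵐ` give the recursion. A
majorant argument (`sum_range_le_of_quadratic_recursion`) shows that the solution converges for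
small `ρ`. Writing `T = ℓ(·) e + S` with small `S`, a contraction argument excludes spectral values
of modulus larger than `|λ|` (`spectralRadius_smulRight_add`), and every eigenvector for `λ` is a
multiple of `f` (`exists_radius`).

Hence the eigenfunctions of any expansion are `f_ρ(0)` times the normalized one. By the identity
theorem for power series, `λ_ρ` has unique coefficients, and the `g_m` are Cauchy products of the
scalars `g_i(0)` with the normalized coefficients, which are polynomials of degree at most their
index (`IsExpansion.eq_sum`). For the numerical values, derivatives of `p φ` integrate to boundary
values at `0`, so each step of the recursion is rational arithmetic in `κ = φ(0)`, and `κ² =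
1/(2π)`. -/

lemma hasSum_sum_antidiagonal_bilin {E F G : Type*} [NormedAddCommGroup E] [NormedSpace ℂ E]
    [NormedAddCommGroup F] [NormedSpace ℂ F] [NormedAddCommGroup G] [NormedSpace ℂ G]
    [CompleteSpace G] (B : E →L[ℂ] F →L[ℂ] G) {a : ℕ → E} {b : ℕ → F} {A : E} {C : F}
    (ha : Summable fun n => ‖a n‖) (hb : Summable fun n => ‖b n‖) (hA : HasSum a A)
    (hC : HasSum b C) :
    HasSum (fun n => ∑ p ∈ Finset.HasAntidiagonal.antidiagonal n, B (a p.1) (b p.2)) (B A C) := by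
  have hs : Summable fun p : ℕ × ℕ => B (a p.1) (b p.2) := by
    refine Summable.of_norm_bounded (g := fun p : ℕ × ℕ => ‖B‖ * (‖a p.1‖ * ‖b p.2‖)) ?_
      fun p => ?_
    · exact (ha.mul_of_nonneg hb (fun _ => norm_nonneg _) (fun _ => norm_nonneg _)).mul_left _
    · rw [← mul_assoc]
      exact B.le_opNorm₂ _ _
  have h1 : ∀ i, HasSum (fun j => B (a i) (b j)) (B (a i) C) := fun i => (B (a i)).hasSum hC
  have h2 : HasSum (fun i => B (a i) C) (B A C) := (B.flip C).hasSum hA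
  -- Absolute convergence allows summation by rows, which gives the value, and then by
  -- antidiagonals.
  have h3 : HasSum (fun p : ℕ × ℕ => B (a p.1) (b p.2)) (B A C) := by
    have := hs.hasSum.prod_fiberwise h1
    rw [this.unique h2] at this
    convert hs.hasSum using 1
    exact h2.unique (hs.hasSum.prod_fiberwise h1)
  have h4 := (Finset.HasAntidiagonal.sigmaAntidiagonalEquivProd.hasSum_iff).2 h3
  refine h4.sigma fun n => ?_
  have := hasSum_fintype (fun p : Finset.HasAntidiagonal.antidiagonal n => B (a p.1.1) (b p.1.2))
  rwa [Finset.sum_coe_sort (Finset.HasAntidiagonal.antidiagonal n) (fun p => B (a p.1) (b p.2))] at this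

/-- The identity theorem for vector-valued power series: both sequences are Taylor coefficients at
`0` of one function. Scalars are real because only real `ρ` occur. -/
lemma eq_of_hasSum_pow_smul {E : Type*} [NormedAddCommGroup E] [NormedSpace ℝ E]
    {g h : ℕ → E} {r : ℝ} (hr : 0 < r)
    (H : ∀ ρ : ℝ, |ρ| < r → ∃ s, HasSum (fun m => ρ ^ m • g m) s ∧
      HasSum (fun m => ρ ^ m • h m) s) : g = h := by
  choose! s hs using H
  let p : (ℕ → E) → FormalMultilinearSeries ℝ ℝ E :=
    fun u n => ContinuousMultilinearMap.mkPiRing ℝ (Fin n) (u n)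
  have hp : ∀ u n, (p u).coeff n = u n := fun u n => by
    simp [FormalMultilinearSeries.coeff, p]
  have key : ∀ u : ℕ → E, (∀ ρ : ℝ, |ρ| < r → HasSum (fun m => ρ ^ m • u m) (s ρ)) →
      HasFPowerSeriesAt s (p u) 0 := by
    intro u hu
    refine hasFPowerSeriesAt_iff.2 ?_
    filter_upwards [Metric.ball_mem_nhds (0 : ℝ) hr] with z hz
    simpa [hp] using hu z (by simpa using hz)
  have := (key g fun ρ hρ => (hs ρ hρ).1).eq_formalMultilinearSeries
    (key h fun ρ hρ => (hs ρ hρ).2)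
  funext n
  rw [← hp g, this, hp]

/-! ### A majorant estimate for a quadratic recursion -/

/-- The pairs with `i + j < N` lie in the square of side `N`, and all terms are nonnegative. -/
lemma sum_range_sum_antidiagonal_le {a b : ℕ → ℝ} (ha : ∀ n, 0 ≤ a n) (hb : ∀ n, 0 ≤ b n)
    (N : ℕ) :
    ∑ m ∈ Finset.range N, ∑ k ∈ Finset.range (m + 1), a k * b (m - k)
      ≤ (∑ i ∈ Finset.range N, a i) * ∑ j ∈ Finset.range N, b j := by
  have h1 : ∀ m, ∑ k ∈ Finset.range (m + 1), a k * b (m - k)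
      = ∑ p ∈ Finset.HasAntidiagonal.antidiagonal m, a p.1 * b p.2 := fun m =>
    (Finset.Nat.sum_antidiagonal_eq_sum_range_succ (fun i j => a i * b j) m).symm
  simp only [h1]
  rw [Finset.sum_mul_sum, ← Finset.sum_product']
  have h2 : ∀ m ∈ Finset.range N,
      ∑ p ∈ Finset.HasAntidiagonal.antidiagonal m, a p.1 * b p.2
        = ∑ p ∈ (Finset.range N ×ˢ Finset.range N) with p.1 + p.2 = m, a p.1 * b p.2 := by
    intro m hm
    refine Finset.sum_congr (Finset.ext fun p => ?_) fun _ _ => rfl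
    simp only [Finset.mem_range, Finset.HasAntidiagonal.mem_antidiagonal, Finset.mem_filter,
      Finset.mem_product] at hm ⊢
    omega
  rw [Finset.sum_congr rfl h2, Finset.sum_fiberwise_eq_sum_filter]
  exact Finset.sum_le_sum_of_subset_of_nonneg (Finset.filter_subset _ _)
    fun p _ _ => mul_nonneg (ha _) (hb _)

/-- A bootstrap. With `δ = 1/(4L)`, if the partial sum `s` is at most `δ`, then the quadratic
contribution to the next partial sum `t` is at most `2L·t·s ≤ t/2` and is absorbed on the left. The
bound `4ε(β 0 + δ) ≤ δ/2` that results closes the induction. It is applied to `β m = ‖ρᵐ g_m‖`. -/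
lemma sum_range_le_of_quadratic_recursion {η β : ℕ → ℝ} {ε L : ℝ} (hη : ∀ n, 0 ≤ η n)
    (hβ : ∀ n, 0 ≤ β n) (hL : 0 < L) (hε : 0 ≤ ε)
    (hsum : ∀ N, ∑ j ∈ Finset.range N, η j ≤ ε)
    (hsmall : 8 * ε * (β 0 + 1 / (4 * L)) ≤ 1 / (4 * L))
    (hrec : ∀ m, β (m + 1) ≤ 2 * (∑ j ∈ Finset.range (m + 1), η j * β (m - j)
      + L * ∑ j ∈ Finset.range m, β (j + 1) * β (m - j))) (N : ℕ) :
    ∑ m ∈ Finset.range N, β (m + 1) ≤ 4 * ε * (β 0 + 1 / (4 * L)) := by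
  have hδ : 0 < 1 / (4 * L) := by positivity
  set δ := 1 / (4 * L) with hδ'
  have hLδ : L * δ = 1 / 4 := by rw [hδ']; field_simp
  have hβ0 := hβ 0
  induction N with
  | zero => simpa using by positivity
  | succ N ih =>
    set s := ∑ m ∈ Finset.range N, β (m + 1) with hs
    set t := ∑ m ∈ Finset.range (N + 1), β (m + 1) with ht
    have hs0 : 0 ≤ s := Finset.sum_nonneg fun m _ => hβ _
    have ht0 : 0 ≤ t := Finset.sum_nonneg fun m _ => hβ _
    -- In the quadratic sum the index `m - j` is never `0`. Removing `β 0` makes the second factor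
    -- `s`, which the induction hypothesis controls, instead of `β 0 + s`.
    let γ : ℕ → ℝ := fun n => if n = 0 then 0 else β n
    have hγ : ∀ n, 0 ≤ γ n := fun n => by
      by_cases h : n = 0
      · simp [γ, h]
      · simpa [γ, h] using hβ n
    have h1 : ∑ j ∈ Finset.range (N + 1), β j = β 0 + s := by
      rw [Finset.sum_range_succ', add_comm]
    have h2 : ∑ j ∈ Finset.range (N + 1), γ j = s := by
      rw [Finset.sum_range_succ']; simp [γ, hs]
    have h3 : ∀ m, ∑ j ∈ Finset.range m, β (j + 1) * β (m - j)
        = ∑ j ∈ Finset.range (m + 1), β (j + 1) * γ (m - j) := by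
      intro m
      rw [Finset.sum_range_succ]
      simp only [Nat.sub_self, γ, if_true, mul_zero, add_zero]
      refine Finset.sum_congr rfl fun j hj => ?_
      rw [if_neg (by have := Finset.mem_range.1 hj; omega)]
    have h4 : t ≤ 2 * (ε * (β 0 + s) + L * (t * s)) := by
      calc t ≤ ∑ m ∈ Finset.range (N + 1), 2 * (∑ j ∈ Finset.range (m + 1), η j * β (m - j)
            + L * ∑ j ∈ Finset.range (m + 1), β (j + 1) * γ (m - j)) :=
            Finset.sum_le_sum fun m _ => (hrec m).trans_eq (by rw [h3])
        _ = 2 * (∑ m ∈ Finset.range (N + 1), ∑ j ∈ Finset.range (m + 1), η j * β (m - j)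
            + L * ∑ m ∈ Finset.range (N + 1),
              ∑ j ∈ Finset.range (m + 1), β (j + 1) * γ (m - j)) := by
            rw [← Finset.mul_sum, Finset.sum_add_distrib, ← Finset.mul_sum]
        _ ≤ 2 * ((∑ j ∈ Finset.range (N + 1), η j) * (∑ j ∈ Finset.range (N + 1), β j)
            + L * (t * ∑ j ∈ Finset.range (N + 1), γ j)) := by
            gcongr
            · exact sum_range_sum_antidiagonal_le hη hβ _
            · exact sum_range_sum_antidiagonal_le (a := fun j => β (j + 1)) (fun _ => hβ _) hγ _
        _ ≤ _ := by
            rw [h1, h2]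
            gcongr
            exact hsum _
    have h5 : s ≤ δ := by nlinarith
    have h6 : L * (t * s) ≤ t / 4 := by
      calc L * (t * s) ≤ L * (t * δ) := by gcongr
        _ = t / 4 := by rw [mul_left_comm, hLδ]; ring
    have h7 : ε * (β 0 + s) ≤ ε * (β 0 + δ) := by gcongr
    nlinarith

/-! ### Spectral radius of a small perturbation of a rank one operator -/

section Spectral

variable {E : Type*} [NormedAddCommGroup E] [NormedSpace ℂ E]

/-- The square of `ℓ(·) v` is `ℓ v` times itself, so the inverse is explicit: `1 + (1 - ℓ v)⁻¹ ℓ(·)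
v`. -/
lemma isUnit_one_sub_smulRight (ℓ : E →L[ℂ] ℂ) (v : E) (h : ℓ v ≠ 1) :
    IsUnit (1 - ℓ.smulRight v) := by
  have h1 : 1 - ℓ v ≠ 0 := sub_ne_zero.2 (Ne.symm h)
  have hsq : ℓ.smulRight v * ℓ.smulRight v = ℓ v • ℓ.smulRight v := by
    ext x; simp [smul_smul, mul_comm]
  have hmul : (1 - ℓ v) * (1 - ℓ v)⁻¹ = 1 := mul_inv_cancel₀ h1
  refine ⟨⟨1 - ℓ.smulRight v, 1 + (1 - ℓ v)⁻¹ • ℓ.smulRight v, ?_, ?_⟩, rfl⟩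
  · rw [sub_mul, one_mul, mul_add, mul_one, mul_smul_comm, hsq, smul_smul]
    have : (1 : E →L[ℂ] E) + (1 - ℓ v)⁻¹ • ℓ.smulRight v
        - (ℓ.smulRight v + ((1 - ℓ v)⁻¹ * ℓ v) • ℓ.smulRight v)
        = 1 + ((1 - ℓ v) * (1 - ℓ v)⁻¹ - 1) • ℓ.smulRight v := by module
    rw [this, hmul]; simp
  · rw [mul_sub, mul_one, add_mul, one_mul, smul_mul_assoc, hsq, smul_smul]
    have : (1 : E →L[ℂ] E) + (1 - ℓ v)⁻¹ • ℓ.smulRight v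
        - (ℓ.smulRight v + ((1 - ℓ v)⁻¹ * ℓ v) • ℓ.smulRight v)
        = 1 + ((1 - ℓ v) * (1 - ℓ v)⁻¹ - 1) • ℓ.smulRight v := by module
    rw [this, hmul]; simp

lemma eq_of_apply_eq_of_norm_lt {S : E →L[ℂ] E} {μ : ℂ} (h : ‖S‖ < ‖μ‖) {u v : E}
    (huv : μ • u - S u = μ • v - S v) : u = v := by
  by_contra hne
  have h0 : 0 < ‖u - v‖ := norm_pos_iff.2 (sub_ne_zero.2 hne)
  have h1 : μ • (u - v) = S (u - v) := by
    rw [smul_sub, map_sub, sub_eq_sub_iff_add_eq_add]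
    rw [sub_eq_sub_iff_add_eq_add] at huv
    rw [huv]; abel
  have h2 := S.le_opNorm (u - v)
  rw [← h1, norm_smul] at h2
  exact absurd (le_of_mul_le_mul_right h2 h0) (not_le.2 h)

/-- If `μ` is larger than the norm of `S`, then either `μ` is in the resolvent set of `ℓ(·) e + S`,
or `ℓ(·) e + S` has an eigenvector `v` for the eigenvalue `μ` with `ℓ v = μ`. -/
lemma mem_resolventSet_or_exists_eigenvector [CompleteSpace E] [Nontrivial E] (ℓ : E →L[ℂ] ℂ)
    (e : E) (S : E →L[ℂ] E) {μ : ℂ} (hμ : ‖S‖ < ‖μ‖) :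
    μ ∈ resolventSet ℂ (ℓ.smulRight e + S) ∨ ∃ v, ℓ v = μ ∧ μ • v - S v = μ • e := by
  have hμS : IsUnit (algebraMap ℂ (E →L[ℂ] E) μ - S) := spectrum.mem_resolventSet_of_norm_lt hμ
  obtain ⟨U, hU⟩ := hμS
  set R : E →L[ℂ] E := ((U⁻¹ : (E →L[ℂ] E)ˣ) : E →L[ℂ] E) with hR
  have hUR : ∀ x, μ • R x - S (R x) = x := by
    intro x
    have : (U : E →L[ℂ] E) * R = 1 := U.mul_inv
    have := congrArg (fun W : E →L[ℂ] E => W x) this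
    rw [hU] at this
    simpa [Algebra.algebraMap_eq_smul_one] using this
  -- With `R = (μ - S)⁻¹` one has `μ - ℓ(·) e - S = (μ - S)(1 - ℓ(·) R e)`, so invertibility is
  -- decided by the value `ℓ (R e)`. In the singular case `μ R e` is the eigenvector.
  by_cases h1 : ℓ (R e) = 1
  · right
    refine ⟨μ • R e, by simp [h1], ?_⟩
    rw [map_smul, ← smul_sub, hUR]
  · left
    have h2 := isUnit_one_sub_smulRight ℓ (R e) h1
    have h3 := U.isUnit.mul h2
    rw [spectrum.mem_resolventSet_iff]
    convert h3 using 1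
    rw [hU]
    ext x
    have h4 := hUR e
    have h5 : (algebraMap ℂ (E →L[ℂ] E) μ - S) (x - ℓ x • R e)
        = μ • x - S x - ℓ x • (μ • R e - S (R e)) := by
      simp [Algebra.algebraMap_eq_smul_one, smul_sub, smul_comm μ (ℓ x)]
      abel
    rw [h4] at h5
    refine Eq.trans ?_ (h5.symm.trans (by simp))
    simp [Algebra.algebraMap_eq_smul_one]
    abel

/-- By `heig`, `f` is an eigenvector for `ℓ f`. A spectral value `k` with `|k| > |ℓ f|` would come
with `v = e + k⁻¹ S v` and `ℓ v = k`. Comparison with `f = e + (ℓ f)⁻¹ S f` shows that `‖v - f‖` is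
at most a fraction of itself, so `v = f` and `k = ℓ f`. -/
theorem spectralRadius_smulRight_add [CompleteSpace E] (ℓ : E →L[ℂ] ℂ) (e : E)
    (S : E →L[ℂ] E) {f : E} {ε L : ℝ} (hL : 0 < L) (hℓ : ‖ℓ‖ ≤ L) (hS : ‖S‖ ≤ ε)
    (hε : ε ≤ 1 / 8) (hsmall : 8 * ε * (‖e‖ + 1 / (4 * L)) ≤ 1 / (4 * L))
    (hf : ‖f‖ ≤ ‖e‖ + 1 / (4 * L)) (hlf : ‖ℓ f - 1 / 2‖ ≤ 1 / 8)
    (heig : ℓ f • f - S f = ℓ f • e) :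
    spectralRadius ℂ (ℓ.smulRight e + S) = ‖ℓ f‖₊ := by
  have hlam : 3 / 8 ≤ ‖ℓ f‖ := by
    have h1 : ‖(1 / 2 : ℂ)‖ = 1 / 2 := by simp
    have h2 := norm_sub_norm_le (1 / 2 : ℂ) (ℓ f)
    rw [norm_sub_rev, h1] at h2
    linarith
  have hlam0 : ℓ f ≠ 0 := norm_pos_iff.1 (by linarith)
  have hf0 : f ≠ 0 := by
    rintro rfl
    simp at hlam0
  have : Nontrivial E := nontrivial_of_ne f 0 hf0
  refine le_antisymm (iSup₂_le fun k hk => ?_) ?_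
  · by_contra! hlt
    have hlt' : ‖ℓ f‖ < ‖k‖ := by exact_mod_cast hlt
    have hk0 : k ≠ 0 := norm_pos_iff.1 (by linarith)
    rcases mem_resolventSet_or_exists_eigenvector ℓ e S (μ := k) (by linarith) with h | ⟨v, hv, h⟩
    · exact hk h
    have hv' : v - k⁻¹ • S v = e := by
      have := congrArg (fun x => k⁻¹ • x) h
      simpa [smul_sub, smul_smul, hk0] using this
    have hf' : f - (ℓ f)⁻¹ • S f = e := by
      have := congrArg (fun x => (ℓ f)⁻¹ • x) heig
      simpa [smul_sub, smul_smul, hlam0] using this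
    -- The two eigenvalues differ, but `k⁻¹ - (ℓ f)⁻¹` is itself a multiple of `ℓ (f - v)`, so the
    -- right side is linear in `v - f`.
    have hd : v - f = S (k⁻¹ • (v - f) + (k⁻¹ * (ℓ f)⁻¹ * ℓ (f - v)) • f) := by
      have h1 : k⁻¹ * (ℓ f)⁻¹ * ℓ (f - v) = k⁻¹ - (ℓ f)⁻¹ := by
        rw [map_sub, hv]; field_simp
      rw [h1]
      have h2 : v - f = k⁻¹ • S v - (ℓ f)⁻¹ • S f := by
        have := hv'.trans hf'.symm
        rw [sub_eq_sub_iff_add_eq_add] at this ⊢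
        rw [this]; abel
      refine h2.trans ?_
      simp only [map_add, map_smul, map_sub]
      module
    have hd0 : 0 < ‖v - f‖ := by
      refine norm_pos_iff.2 (sub_ne_zero.2 ?_)
      rintro rfl
      rw [hv] at hlt'
      exact lt_irrefl _ hlt'
    have hki : ‖k⁻¹‖ ≤ 8 / 3 := by
      rw [norm_inv, inv_le_comm₀ (by linarith) (by norm_num)]; norm_num; linarith
    have hli : ‖(ℓ f)⁻¹‖ ≤ 8 / 3 := by
      rw [norm_inv, inv_le_comm₀ (by linarith) (by norm_num)]; norm_num; linarith
    have hε0 : 0 ≤ ε := (norm_nonneg _).trans hS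
    have hB : 0 ≤ ‖e‖ + 1 / (4 * L) := by positivity
    have h1 : ‖v - f‖ ≤ ε * (8 / 3 * ‖v - f‖ + (8 / 3 * (8 / 3) * (L * ‖v - f‖))
        * (‖e‖ + 1 / (4 * L))) := by
      calc ‖v - f‖ = ‖S (k⁻¹ • (v - f) + (k⁻¹ * (ℓ f)⁻¹ * ℓ (f - v)) • f)‖ := by rw [← hd]
        _ ≤ ‖S‖ * ‖k⁻¹ • (v - f) + (k⁻¹ * (ℓ f)⁻¹ * ℓ (f - v)) • f‖ := S.le_opNorm _
        _ ≤ ‖S‖ * (‖k⁻¹‖ * ‖v - f‖ + (‖k⁻¹‖ * ‖(ℓ f)⁻¹‖ * (‖ℓ‖ * ‖v - f‖)) * ‖f‖) := by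
            gcongr
            refine (norm_add_le _ _).trans ?_
            rw [norm_smul, norm_smul, norm_mul, norm_mul]
            gcongr
            rw [norm_sub_rev v f]
            exact ℓ.le_opNorm _
        _ ≤ _ := by gcongr
    have h2 : ε * (L * (‖e‖ + 1 / (4 * L))) ≤ 1 / 32 := by
      have h3 := mul_le_mul_of_nonneg_left hsmall hL.le
      have h4 : L * (1 / (4 * L)) = 1 / 4 := by field_simp
      rw [h4] at h3
      linarith
    -- The factor in front of `‖v - f‖` is at most `1/8 · 8/3 + 64/9 · 1/32 = 5/9 < 1`.
    nlinarith
  · refine le_iSup₂_of_le (f := fun (k : ℂ) (_ : k ∈ spectrum ℂ (ℓ.smulRight e + S)) =>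
      ((‖k‖₊ : NNReal) : ENNReal)) (ℓ f) ?_ le_rfl
    rw [spectrum.mem_iff]
    rintro ⟨U, hU⟩
    have h1 : (U : E →L[ℂ] E) f = 0 := by
      rw [hU]
      have : (algebraMap ℂ (E →L[ℂ] E) (ℓ f) - (ℓ.smulRight e + S)) f
          = ℓ f • f - S f - ℓ f • e := by
        simp [Algebra.algebraMap_eq_smul_one]; abel
      rw [this, heig, sub_self]
    have h2 : ((U⁻¹ : (E →L[ℂ] E)ˣ) : E →L[ℂ] E) ((U : E →L[ℂ] E) f) = f := by
      have : ((U⁻¹ : (E →L[ℂ] E)ˣ) : E →L[ℂ] E) * (U : E →L[ℂ] E) = 1 := U.inv_mul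
      exact congrArg (fun W : E →L[ℂ] E => W f) this
    rw [h1, map_zero] at h2
    exact hf0 h2.symm

end Spectral

lemma hasSum_sum_antidiagonal_apply {E : Type*} [NormedAddCommGroup E] [NormedSpace ℂ E]
    [CompleteSpace E] {a : ℕ → E →L[ℂ] E} {b : ℕ → E} {A : E →L[ℂ] E} {C : E}
    (ha : Summable fun n => ‖a n‖) (hb : Summable fun n => ‖b n‖) (hA : HasSum a A)
    (hC : HasSum b C) :
    HasSum (fun n => ∑ p ∈ Finset.HasAntidiagonal.antidiagonal n, a p.1 (b p.2)) (A C) :=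
  hasSum_sum_antidiagonal_bilin (ContinuousLinearMap.id ℂ (E →L[ℂ] E)) ha hb hA hC

lemma hasSum_sum_antidiagonal_smul {E : Type*} [NormedAddCommGroup E] [NormedSpace ℂ E]
    [CompleteSpace E] {a : ℕ → ℂ} {b : ℕ → E} {A : ℂ} {C : E}
    (ha : Summable fun n => ‖a n‖) (hb : Summable fun n => ‖b n‖) (hA : HasSum a A)
    (hC : HasSum b C) :
    HasSum (fun n => ∑ p ∈ Finset.HasAntidiagonal.antidiagonal n, a p.1 • b p.2) (A • C) :=
  hasSum_sum_antidiagonal_bilin (ContinuousLinearMap.lsmul ℂ ℂ) ha hb hA hC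

/-! ### Analytic perturbation of a rank one operator -/

/-- The data of an operator-valued power series `∑ ρⁿ P_n`, where `P_0 = ℓ(·) e` with `ℓ e = 1/2`,
and where the functional `ev`, with `ev e = 1`, vanishes on the range of `P_n` for `n ≥ 1`. -/
structure RankOnePerturbation (E : Type*) [NormedAddCommGroup E] [NormedSpace ℂ E] where
  P : ℕ → E →L[ℂ] E
  ℓ : E →L[ℂ] ℂ
  ev : E →L[ℂ] ℂ
  e : E
  A : ℝ
  D : ℝ
  P_zero : P 0 = ℓ.smulRight e
  ℓ_e : ℓ e = 1 / 2
  ev_e : ev e = 1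
  ev_P : ∀ n h, ev (P (n + 1) h) = 0
  norm_P_le : ∀ n, ‖P n‖ ≤ A * D ^ n
  A_nonneg : 0 ≤ A
  D_pos : 0 < D

namespace RankOnePerturbation

variable {E : Type*} [NormedAddCommGroup E] [NormedSpace ℂ E]

/-- The recursion for the coefficients of the normalized eigenvector. -/
def IsSolution (R : RankOnePerturbation E) (g : ℕ → E) : Prop :=
  g 0 = R.e ∧ ∀ m, g (m + 1) = (2 : ℂ) • (∑ j ∈ Finset.range (m + 1), R.P (j + 1) (g (m - j))
    - ∑ j ∈ Finset.range m, R.ℓ (g (j + 1)) • g (m - j))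

/-- The operators of positive index map into the kernel of `ev`, and the vectors `g (m - j)` in the
quadratic sum have indices from `1` to `m`. Thus the recursion preserves the normalization `ev f =
1`. -/
lemma IsSolution.ev_eq {R : RankOnePerturbation E} {g : ℕ → E} (hg : R.IsSolution g) (m : ℕ) :
    R.ev (g (m + 1)) = 0 := by
  induction m using Nat.strong_induction_on with
  | _ m ih =>
    rw [hg.2, map_smul, map_sub, map_sum, map_sum]
    simp only [R.ev_P, Finset.sum_const_zero, zero_sub, map_smul]
    rw [Finset.sum_eq_zero, neg_zero, smul_zero]
    intro j hj
    have hj' := Finset.mem_range.1 hj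
    obtain ⟨k, hk⟩ : ∃ k, m - j = k + 1 := ⟨m - j - 1, by omega⟩
    rw [hk, ih k (by omega), smul_zero]

/-- This is the coefficient of `ρᵐ` in `T f = ℓ(f) f`. For `m ≥ 1` the term `P_0 g_m = ℓ(g_m) e`
cancels `ℓ(g_m) g_0`, and `ℓ(g_0) g_m = ½ g_m` remains; solving for `g_m` is the recursion, with its
factor `2`. -/
lemma IsSolution.sum_eq {R : RankOnePerturbation E} {g : ℕ → E} (hg : R.IsSolution g) (m : ℕ) :
    ∑ p ∈ Finset.HasAntidiagonal.antidiagonal m, R.P p.1 (g p.2)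
      = ∑ p ∈ Finset.HasAntidiagonal.antidiagonal m, R.ℓ (g p.1) • g p.2 := by
  rw [Finset.Nat.sum_antidiagonal_eq_sum_range_succ (fun i j => R.P i (g j)),
    Finset.Nat.sum_antidiagonal_eq_sum_range_succ (fun i j => R.ℓ (g i) • g j)]
  cases m with
  | zero => simp [R.P_zero, hg.1]
  | succ m =>
    rw [Finset.sum_range_succ', Finset.sum_range_succ' _ (m + 1),
      Finset.sum_range_succ (fun j => R.ℓ (g (j + 1)) • g (m + 1 - (j + 1)))]
    simp only [Nat.add_sub_add_right, Nat.sub_zero, Nat.sub_self, R.P_zero, hg.1, R.ℓ_e,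
      ContinuousLinearMap.smulRight_apply]
    have h := hg.2 m
    have h2 : (1 / 2 : ℂ) • g (m + 1) = (∑ j ∈ Finset.range (m + 1), R.P (j + 1) (g (m - j))
        - ∑ j ∈ Finset.range m, R.ℓ (g (j + 1)) • g (m - j)) := by
      rw [h, smul_smul]; norm_num
    rw [h2]
    abel

set_option maxHeartbeats 1000000 in
/-- For small real `ρ` the solution of the recursion is the expansion of the leading
eigenvector of `∑ ρⁿ P_n`. -/
theorem exists_radius [CompleteSpace E] (R : RankOnePerturbation E) {g : ℕ → E}
    (hg : R.IsSolution g) :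
    ∃ r > 0, ∀ ρ : ℝ, |ρ| < r → ∃ (T : E →L[ℂ] E) (f : E),
      HasSum (fun n => (ρ : ℂ) ^ n • R.P n) T ∧ (Summable fun m => ‖(ρ : ℂ) ^ m • g m‖) ∧
      HasSum (fun m => (ρ : ℂ) ^ m • g m) f ∧ R.ev f = 1 ∧ T f = R.ℓ f • f ∧
      ‖R.ℓ f - 1 / 2‖ ≤ 1 / 8 ∧ spectralRadius ℂ T = ‖R.ℓ f‖₊ ∧
      ∀ h, T h = R.ℓ f • h → h = R.ev h • f := by
  -- The summand `1` keeps `L` positive, so that `δ` makes sense.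
  set L := ‖R.ℓ‖ + 1 with hLdef
  have hL : 0 < L := by positivity
  set δ := 1 / (4 * L) with hδdef
  have hδ : 0 < δ := by positivity
  have hLδ : L * δ = 1 / 4 := by rw [hδdef]; field_simp
  -- The first bound is for the spectral radius; the second is the smallness condition of both the
  -- majorant estimate and the contraction.
  set ε := min (1 / 8) (δ / (8 * (‖R.e‖ + δ))) with hεdef
  have hε : 0 < ε := by positivity
  have hε8 : ε ≤ 1 / 8 := min_le_left _ _
  have hsmall : 8 * ε * (‖R.e‖ + δ) ≤ δ := by
    have : ε ≤ δ / (8 * (‖R.e‖ + δ)) := min_le_right _ _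
    rw [le_div_iff₀ (by positivity)] at this
    linarith
  have hD := R.D_pos
  have hA := R.A_nonneg
  -- With `x = |ρ| D ≤ 1/2` the higher terms have total norm at most `A x / (1 - x) ≤ 2 A x ≤ ε`.
  -- Using `A + 1` avoids division by zero.
  refine ⟨min (1 / (2 * R.D)) (ε / (2 * (R.A + 1) * R.D)), by positivity, fun ρ hρ => ?_⟩
  set x := |ρ| * R.D with hx
  have hx0 : 0 ≤ x := by positivity
  have hx1 : x ≤ 1 / 2 := by
    have := (hρ.trans_le (min_le_left _ _)).le
    rw [le_div_iff₀ (by positivity)] at this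
    linarith
  have hx2 : 2 * (R.A + 1) * x ≤ ε := by
    have := (hρ.trans_le (min_le_right _ _)).le
    rw [le_div_iff₀ (by positivity)] at this
    linarith
  have hη : ∀ n, ‖(ρ : ℂ) ^ n • R.P n‖ ≤ R.A * x ^ n := fun n => by
    rw [norm_smul, norm_pow, Complex.norm_real, Real.norm_eq_abs, hx, mul_pow]
    calc _ ≤ |ρ| ^ n * (R.A * R.D ^ n) := by gcongr; exact R.norm_P_le n
      _ = _ := by ring
  have hgeom : HasSum (fun n => R.A * x ^ (n + 1)) (R.A * x / (1 - x)) := by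
    have := (hasSum_geometric_of_lt_one hx0 (by linarith)).mul_left (R.A * x)
    have h : (fun n => R.A * x ^ (n + 1)) = fun n => R.A * x * x ^ n := by
      funext n
      ring
    rwa [h, div_eq_mul_inv]
  have hgeom_le : R.A * x / (1 - x) ≤ ε := by
    rw [div_le_iff₀ (by linarith)]
    nlinarith
  have hPs : Summable fun n => ‖(ρ : ℂ) ^ n • R.P n‖ := by
    refine Summable.of_nonneg_of_le (fun _ => norm_nonneg _) hη ?_
    exact (summable_geometric_of_lt_one hx0 (by linarith)).mul_left _
  have hT := hPs.of_norm.hasSum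
  set T := ∑' n, (ρ : ℂ) ^ n • R.P n with hTdef
  have hS : HasSum (fun n => (ρ : ℂ) ^ (n + 1) • R.P (n + 1)) (T - R.P 0) := by
    have := (hasSum_nat_add_iff' 1).2 hT
    simpa using this
  set S := T - R.P 0 with hSdef
  have hTS : T = R.ℓ.smulRight R.e + S := by rw [hSdef, R.P_zero]; abel
  have hSε : ‖S‖ ≤ ε := by
    refine le_trans ?_ hgeom_le
    rw [← hS.tsum_eq]
    exact tsum_of_norm_bounded hgeom fun n => hη _
  have hevS : ∀ h, R.ev (S h) = 0 := by
    intro h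
    have h1 : HasSum (fun n => R.ev (((ρ : ℂ) ^ (n + 1) • R.P (n + 1)) h)) (R.ev (S h)) :=
      (R.ev.comp (ContinuousLinearMap.apply ℂ E h)).hasSum hS
    simp only [smul_apply, map_smul, R.ev_P, smul_zero] at h1
    exact h1.unique hasSum_zero
  -- Indices add up to `m + 1` in each term of the recursion, so the vectors `ρᵐ g_m` satisfy it
  -- with `ρⁿ P_n` in place of `P_n`.
  have hbound := sum_range_le_of_quadratic_recursion (η := fun j => R.A * x ^ (j + 1))
    (β := fun m => ‖(ρ : ℂ) ^ m • g m‖) (ε := ε) (L := L) (fun n => by positivity)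
    (fun n => norm_nonneg _) hL hε.le
    (fun N => (hgeom.summable.sum_le_tsum _ fun n _ => by positivity).trans
      (hgeom.tsum_eq.trans_le hgeom_le)) (by
        rw [pow_zero, one_smul, hg.1]
        exact hsmall) (fun m => by
        have h1 : (ρ : ℂ) ^ (m + 1) • g (m + 1) = (2 : ℂ) •
            (∑ j ∈ Finset.range (m + 1), ((ρ : ℂ) ^ (j + 1) • R.P (j + 1)) ((ρ : ℂ) ^ (m - j) • g (m - j))
              - ∑ j ∈ Finset.range m, R.ℓ ((ρ : ℂ) ^ (j + 1) • g (j + 1)) •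
                ((ρ : ℂ) ^ (m - j) • g (m - j))) := by
          rw [hg.2, smul_comm, smul_sub, Finset.smul_sum, Finset.smul_sum]
          congr 2
          · refine Finset.sum_congr rfl fun j hj => ?_
            have hj' := Finset.mem_range.1 hj
            rw [smul_apply, map_smul, smul_smul, ← pow_add]
            congr 2; omega
          · refine Finset.sum_congr rfl fun j hj => ?_
            have hj' := Finset.mem_range.1 hj
            rw [map_smul, smul_eq_mul, smul_smul, smul_smul]
            congr 1
            rw [mul_right_comm, ← pow_add]
            congr 2; omega
        rw [h1, norm_smul]
        simp only [Complex.norm_ofNat]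
        gcongr
        refine (norm_sub_le _ _).trans (add_le_add ?_ ?_)
        · refine (norm_sum_le _ _).trans (Finset.sum_le_sum fun j _ => ?_)
          refine (ContinuousLinearMap.le_opNorm _ _).trans ?_
          gcongr
          exact hη _
        · rw [Finset.mul_sum]
          refine (norm_sum_le _ _).trans (Finset.sum_le_sum fun j _ => ?_)
          rw [norm_smul, ← mul_assoc]
          gcongr
          refine (R.ℓ.le_opNorm _).trans ?_
          gcongr
          simp [hLdef])
  simp only [pow_zero, one_smul, hg.1] at hbound
  have hgs1 : Summable fun m => ‖(ρ : ℂ) ^ (m + 1) • g (m + 1)‖ :=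
    summable_of_sum_range_le (fun _ => norm_nonneg _) hbound
  have hgs : Summable fun m => ‖(ρ : ℂ) ^ m • g m‖ :=
    (summable_nat_add_iff (f := fun m => ‖(ρ : ℂ) ^ m • g m‖) 1).1 hgs1
  have hf := hgs.of_norm.hasSum
  set f := ∑' m, (ρ : ℂ) ^ m • g m with hfdef
  have hfe : HasSum (fun m => (ρ : ℂ) ^ (m + 1) • g (m + 1)) (f - R.e) := by
    have := (hasSum_nat_add_iff' 1).2 hf
    simpa [hg.1] using this
  have hfe_norm : ‖f - R.e‖ ≤ 4 * ε * (‖R.e‖ + δ) := by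
    rw [← hfe.tsum_eq]
    refine (norm_tsum_le_tsum_norm hgs1).trans ?_
    exact hgs1.tsum_le_of_sum_range_le hbound
  have hfnorm : ‖f‖ ≤ ‖R.e‖ + δ := by
    have := norm_add_le R.e (f - R.e)
    rw [add_sub_cancel] at this
    linarith
  have hevf : R.ev f = 1 := by
    have h1 : HasSum (fun m => R.ev ((ρ : ℂ) ^ (m + 1) • g (m + 1))) (R.ev (f - R.e)) :=
      R.ev.hasSum hfe
    simp only [map_smul, hg.ev_eq, smul_zero] at h1
    have := h1.unique hasSum_zero
    rwa [map_sub, R.ev_e, sub_eq_zero] at this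
  have hℓf : ‖R.ℓ f - 1 / 2‖ ≤ 1 / 8 := by
    rw [← R.ℓ_e, ← map_sub]
    have h1 : ‖f - R.e‖ ≤ δ / 2 := by linarith
    calc _ ≤ ‖R.ℓ‖ * ‖f - R.e‖ := R.ℓ.le_opNorm _
      _ ≤ L * (δ / 2) := by gcongr; simp [hLdef]
      _ = 1 / 8 := by rw [← mul_div_assoc, hLδ]; norm_num
  -- Both sides are Cauchy products, and they agree degree by degree.
  have hTf : T f = R.ℓ f • f := by
    have hls : Summable fun m => ‖R.ℓ ((ρ : ℂ) ^ m • g m)‖ :=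
      Summable.of_nonneg_of_le (fun _ => norm_nonneg _) (fun m => R.ℓ.le_opNorm _)
        (hgs.mul_left _)
    have h1 := hasSum_sum_antidiagonal_apply hPs hgs hT hf
    have h2 := hasSum_sum_antidiagonal_smul hls hgs (R.ℓ.hasSum hf) hf
    have h3 : ∀ n, ∑ p ∈ Finset.HasAntidiagonal.antidiagonal n,
        ((ρ : ℂ) ^ p.1 • R.P p.1) ((ρ : ℂ) ^ p.2 • g p.2)
        = ∑ p ∈ Finset.HasAntidiagonal.antidiagonal n,
          R.ℓ ((ρ : ℂ) ^ p.1 • g p.1) • (ρ : ℂ) ^ p.2 • g p.2 := by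
      intro n
      have h4 := congrArg (fun u => (ρ : ℂ) ^ n • u) (hg.sum_eq n)
      simp only [Finset.smul_sum] at h4
      convert h4 using 1
      · refine Finset.sum_congr rfl fun p hp => ?_
        rw [smul_apply, map_smul, smul_smul, ← pow_add,
          Finset.HasAntidiagonal.mem_antidiagonal.1 hp]
      · refine Finset.sum_congr rfl fun p hp => ?_
        rw [map_smul, smul_eq_mul, smul_smul, smul_smul, mul_right_comm, ← pow_add,
          Finset.HasAntidiagonal.mem_antidiagonal.1 hp]
    simp only [h3] at h1
    exact h1.unique h2
  have heig : R.ℓ f • f - S f = R.ℓ f • R.e := by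
    rw [← hTf, hTS]; simp
  have hlam : 3 / 8 ≤ ‖R.ℓ f‖ := by
    have h1 : ‖(1 / 2 : ℂ)‖ = 1 / 2 := by simp
    have h2 := norm_sub_norm_le (1 / 2 : ℂ) (R.ℓ f)
    rw [norm_sub_rev, h1] at h2
    linarith
  have hlam0 : R.ℓ f ≠ 0 := norm_pos_iff.1 (by linarith)
  refine ⟨T, f, hT, hgs, hf, hevf, hTf, hℓf, ?_, fun h hh => ?_⟩
  · rw [hTS]
    exact spectralRadius_smulRight_add R.ℓ R.e S hL (by simp [hLdef]) hSε hε8 hsmall hfnorm hℓf heig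
  -- Applying `ev` to `T h = λ h` kills `S h` and gives `ℓ h = λ ev h`. Then `h` and `ev h • f` have
  -- the same image under `λ - S`, which is injective because `‖S‖ < |λ|`.
  · have h1 : R.ℓ h = R.ℓ f * R.ev h := by
      have := congrArg R.ev hh
      rw [hTS] at this
      simpa [hevS, R.ev_e] using this
    refine eq_of_apply_eq_of_norm_lt (S := S) (μ := R.ℓ f) (by linarith) ?_
    have h2 : R.ℓ f • h - S h = R.ℓ h • R.e := by
      rw [← hh, hTS]; simp
    rw [h2, h1, map_smul, smul_comm, ← smul_sub, heig, smul_smul, mul_comm]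

end RankOnePerturbation

/-! ### Recurrence relations for the Hermite polynomials -/

lemma derivative_hermR_succ (n : ℕ) :
    Polynomial.derivative (hermR (n + 1)) = Polynomial.C ((n : ℝ) + 1) * hermR n := by
  induction n with
  | zero => simp [hermR]
  | succ n ih =>
    rw [hermR_succ (n + 1), Polynomial.derivative_sub, Polynomial.derivative_mul, ih,
      Polynomial.derivative_mul, Polynomial.derivative_C, hermR_succ n]
    simp only [Polynomial.derivative_X, Nat.cast_add, Nat.cast_one, map_add, map_one]
    ring

lemma X_mul_hermR_succ (n : ℕ) :
    Polynomial.X * hermR (n + 1) = hermR (n + 2) + Polynomial.C ((n : ℝ) + 1) * hermR n := by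
  rw [hermR_succ (n + 1), derivative_hermR_succ]; ring

lemma sqrt_factorial_succ (n : ℕ) :
    Real.sqrt ((n + 1).factorial : ℝ) = Real.sqrt (n + 1) * Real.sqrt (n.factorial : ℝ) := by
  rw [Nat.factorial_succ, Nat.cast_mul, Real.sqrt_mul (by positivity)]
  push_cast; rfl

/-- The three-term recurrence. For `n = 0` the truncated index `n - 1` is harmless, its coefficient
being `√0`. -/
lemma mul_hermiteHat (n : ℕ) (x : ℝ) :
    x * hermiteHat n x
      = Real.sqrt (n + 1) * hermiteHat (n + 1) x + Real.sqrt n * hermiteHat (n - 1) x := by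
  have hpos : ∀ n : ℕ, 0 < Real.sqrt (n.factorial : ℝ) := fun n =>
    Real.sqrt_pos.2 (by positivity)
  cases n with
  | zero => simp [hermiteHat_eq, hermR, Polynomial.hermite_succ]
  | succ n =>
    have h := congrArg (Polynomial.eval x) (X_mul_hermR_succ n)
    simp only [Polynomial.eval_mul, Polynomial.eval_X, Polynomial.eval_add,
      Polynomial.eval_C] at h
    simp only [hermiteHat_eq, Nat.add_sub_cancel]
    rw [mul_div_assoc', h, add_div, sqrt_factorial_succ (n + 1)]
    have h1 : Real.sqrt ((n + 1 : ℕ) + 1 : ℝ) ≠ 0 := (Real.sqrt_pos.2 (by positivity)).ne'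
    have h2 := (hpos n).ne'
    have h3 := (hpos (n + 1)).ne'
    congr 1
    · field_simp
    · rw [sqrt_factorial_succ]
      have h4 : Real.sqrt ((n : ℝ) + 1) ≠ 0 := (Real.sqrt_pos.2 (by positivity)).ne'
      have h5 : Real.sqrt ((n : ℝ) + 1) * Real.sqrt ((n : ℝ) + 1) = n + 1 :=
        Real.mul_self_sqrt (by positivity)
      push_cast
      field_simp
      rw [sq, h5, mul_comm]

lemma abs_hermiteHat_succ_succ_le (n : ℕ) (x : ℝ) :
    |hermiteHat (n + 2) x| ≤ |x| / Real.sqrt (n + 2) * |hermiteHat (n + 1) x|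
      + |hermiteHat n x| := by
  have h := mul_hermiteHat (n + 1) x
  have h0 : 0 < Real.sqrt ((n : ℝ) + 2) := Real.sqrt_pos.2 (by positivity)
  have h1 : Real.sqrt ((n : ℝ) + 1) ≤ Real.sqrt ((n : ℝ) + 2) := Real.sqrt_le_sqrt (by linarith)
  push_cast at h
  rw [add_assoc, one_add_one_eq_two] at h
  have h2 : hermiteHat (n + 2) x = x / Real.sqrt (n + 2) * hermiteHat (n + 1) x
      - Real.sqrt (n + 1) / Real.sqrt (n + 2) * hermiteHat n x := by
    field_simp
    linarith
  rw [h2]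
  refine (abs_sub _ _).trans (add_le_add ?_ ?_)
  · rw [abs_mul, abs_div, abs_of_pos h0]
  · rw [abs_mul, abs_of_nonneg (by positivity)]
    refine mul_le_of_le_one_left (abs_nonneg _) ?_
    rwa [div_le_one h0]

/-- The maximum of two consecutive `|ĥ_n(x)|` grows by a factor of at most `1 + |x|/√(n+2)`, which
tends to `1`, so the ratio test applies. This makes point evaluations continuous on `ℋ_q`. -/
lemma summable_pow_mul_hermiteHat_sq {q : ℝ} (hq0 : 0 < q) (hq1 : q < 1) (x : ℝ) :
    Summable fun n => q ^ n * hermiteHat n x ^ 2 := by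
  set M : ℕ → ℝ := fun n => max |hermiteHat n x| |hermiteHat (n + 1) x| with hM
  have hM0 : ∀ n, 0 ≤ M n := fun n => le_max_of_le_left (abs_nonneg _)
  have hstep : ∀ n : ℕ, M (n + 1) ≤ (1 + |x| / Real.sqrt (n + 2)) * M n := by
    intro n
    have h0 : 0 ≤ |x| / Real.sqrt (n + 2) := by positivity
    have h1 : |hermiteHat (n + 1) x| ≤ M n := le_max_right _ _
    have h2 : |hermiteHat n x| ≤ M n := le_max_left _ _
    refine max_le ?_ ?_
    · nlinarith [mul_nonneg h0 (hM0 n)]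
    · have := abs_hermiteHat_succ_succ_le n x
      nlinarith [mul_le_mul_of_nonneg_left h1 h0]
  have hlim : Filter.Tendsto (fun n : ℕ => q * (1 + |x| / Real.sqrt (n + 2)) ^ 2) Filter.atTop
      (nhds (q * (1 + 0) ^ 2)) := by
    refine Filter.Tendsto.const_mul _ (((tendsto_const_nhds).add ?_).pow 2)
    refine Filter.Tendsto.div_atTop tendsto_const_nhds ?_
    exact Real.tendsto_sqrt_atTop.comp
      (Filter.tendsto_atTop_add_const_right _ _ tendsto_natCast_atTop_atTop)
  obtain ⟨c, hc1, hc2⟩ := exists_between hq1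
  have hev := hlim.eventually_lt_const (show q * (1 + 0) ^ 2 < c by simpa using hc1)
  have hs : Summable fun n => q ^ n * M n ^ 2 := by
    refine summable_of_ratio_norm_eventually_le hc2 ?_
    filter_upwards [hev] with n hn
    rw [Real.norm_of_nonneg (by positivity), Real.norm_of_nonneg (by positivity)]
    calc q ^ (n + 1) * M (n + 1) ^ 2
        ≤ q ^ (n + 1) * ((1 + |x| / Real.sqrt (n + 2)) * M n) ^ 2 := by
          gcongr
          exact hstep n
      _ = q * (1 + |x| / Real.sqrt (n + 2)) ^ 2 * (q ^ n * M n ^ 2) := by ring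
      _ ≤ _ := by gcongr
  refine Summable.of_nonneg_of_le (fun n => by positivity) (fun n => ?_) hs
  rw [← sq_abs]
  gcongr
  exact le_max_left _ _

/-! ### The space `ℋ_q` -/

variable {q : Set.Ioo (0 : ℝ) 1}

variable (q) in
/-- The weight `q^(k/2)`. -/
def wt (k : ℕ) : ℝ := Real.sqrt ((q : ℝ) ^ k)

lemma wt_pos (k : ℕ) : 0 < wt q k := Real.sqrt_pos.2 (pow_pos q.2.1 k)

lemma wt_sq (k : ℕ) : wt q k ^ 2 = (q : ℝ) ^ k := Real.sq_sqrt (pow_pos q.2.1 k).le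

lemma Hq.toL2_apply (f : Hq q) (k : ℕ) : Hq.toL2 f k = f.coeff k * ((wt q k)⁻¹ : ℝ) := rfl

/-! ### `ℋ_q` as an isometric copy of `ℓ²` -/

lemma summable_norm_mul_of_sq {a b : ℕ → ℂ} (ha : Summable fun n => ‖a n‖ ^ 2)
    (hb : Summable fun n => ‖b n‖ ^ 2) : Summable fun n => ‖a n * b n‖ := by
  refine Summable.of_nonneg_of_le (fun _ => norm_nonneg _) (fun n => ?_) (ha.add hb)
  rw [norm_mul]
  nlinarith [sq_nonneg (‖a n‖ - ‖b n‖), sq_nonneg ‖a n‖, sq_nonneg ‖b n‖]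

lemma summable_norm_sq_of_lp (b : lp (fun _ : ℕ => ℂ) 2) : Summable fun n => ‖b n‖ ^ 2 := by
  have := (memℓp_gen_iff (p := 2) (by simp)).1 b.2
  simpa using this

/-- Since `q^(n/2) ĥ_n(x)` is square summable, the weighted series of any `ℓ²` sequence converges at
every `x` and defines a function. Completeness of `ℋ_q` follows. -/
lemma Hq.toL2_surjective : Function.Surjective (Hq.toL2 (q := q)) := by
  intro b
  have hb := summable_norm_sq_of_lp b
  set a : ℕ → ℂ := fun n => b n * (wt q n : ℂ) with ha
  have hs : ∀ x, Summable fun n => a n * (hermiteHat n x : ℂ) := by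
    intro x
    have h1 : Summable fun n => ‖((wt q n * hermiteHat n x : ℝ) : ℂ)‖ ^ 2 := by
      refine (summable_pow_mul_hermiteHat_sq q.2.1 q.2.2 x).congr fun n => ?_
      rw [Complex.norm_real, Real.norm_eq_abs, sq_abs, mul_pow, wt_sq]
    refine ((summable_norm_mul_of_sq hb h1).of_norm).congr fun n => ?_
    simp [ha, mul_assoc]
  have hc : IsCoeff q a (fun x => ∑' n, a n * (hermiteHat n x : ℂ)) := by
    refine ⟨hb.congr fun n => ?_, fun x => (hs x).hasSum⟩
    have := (pow_pos q.2.1 n).ne'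
    rw [ha, norm_mul, mul_pow, Complex.norm_real, Real.norm_eq_abs, sq_abs, wt_sq, mul_assoc,
      mul_inv_cancel₀ this, mul_one]
  let f : Hq q := ⟨_, a, hc⟩
  refine ⟨f, ?_⟩
  have hf : f.coeff = a := f.isCoeff.unique hc
  ext n
  have h0 : (wt q n : ℂ) ≠ 0 := by exact_mod_cast (wt_pos n).ne'
  rw [Hq.toL2_apply, hf, ha]
  push_cast
  rw [mul_assoc, mul_inv_cancel₀ h0, mul_one]

variable (q) in
/-- The isometric isomorphism of `ℋ_q` with `ℓ²`. -/
def Hq.equivL2 : Hq q ≃ₗᵢ[ℂ] lp (fun _ : ℕ => ℂ) 2 where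
  toLinearEquiv := LinearEquiv.ofBijective Hq.toL2 ⟨Hq.toL2_injective, Hq.toL2_surjective⟩
  norm_map' _ := rfl

lemma Hq.equivL2_apply (f : Hq q) (k : ℕ) :
    Hq.equivL2 q f k = f.coeff k * ((wt q k)⁻¹ : ℝ) := rfl

instance : CompleteSpace (Hq q) :=
  (Hq.equivL2 q).isometry.isUniformInducing.completeSpace (by
    rw [(Hq.equivL2 q).surjective.range_eq]
    exact isComplete_univ)

variable (q) in
/-- The normalized Hermite polynomial `ĥ_k` as an element of `ℋ_q`. -/
def hermHq (k : ℕ) : Hq q := (Hq.equivL2 q).symm (lp.single 2 k ((wt q k)⁻¹ : ℂ))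

lemma norm_hermHq (k : ℕ) : ‖hermHq q k‖ = (wt q k)⁻¹ := by
  rw [hermHq, LinearIsometryEquiv.norm_map, lp.norm_single (by simp), norm_inv, Complex.norm_real,
    Real.norm_of_nonneg (wt_pos k).le]

lemma coeff_hermHq (k : ℕ) : (hermHq q k).coeff = Pi.single k 1 := by
  funext n
  have h := Hq.equivL2_apply (hermHq q k) n
  rw [hermHq, LinearIsometryEquiv.apply_symm_apply, ← hermHq, lp.single_apply] at h
  have h0 : (wt q n : ℂ) ≠ 0 := by exact_mod_cast (wt_pos n).ne'
  have h1 : (hermHq q k).coeff n = Pi.single (M := fun _ => ℂ) k ((wt q k)⁻¹ : ℂ) n * wt q n := by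
    rw [h]; push_cast; rw [mul_assoc, inv_mul_cancel₀ h0, mul_one]
  rw [h1]
  by_cases hn : n = k
  · subst hn; simp [h0]
  · simp [hn]

lemma hermHq_apply (k : ℕ) (x : ℝ) : hermHq q k x = hermiteHat k x := by
  have h := (hermHq q k).isCoeff.2 x
  rw [coeff_hermHq] at h
  refine h.unique ?_
  convert hasSum_single (f := fun n => (Pi.single k 1 : ℕ → ℂ) n * (hermiteHat n x : ℂ)) k ?_ using 1
  · simp
  · intro n hn; simp [hn]

/-- The convergence here is in the norm, whereas `IsCoeff` gives it pointwise. It lets continuous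
operators be compared on the Hermite basis. -/
lemma Hq.hasSum_coeff (f : Hq q) : HasSum (fun k => f.coeff k • hermHq q k) f := by
  have h := lp.hasSum_single (p := 2) (by simp) (Hq.equivL2 q f)
  have h1 := (Hq.equivL2 q).symm.toContinuousLinearEquiv.toContinuousLinearMap.hasSum h
  have h2 : (Hq.equivL2 q).symm (Hq.equivL2 q f) = f := LinearIsometryEquiv.symm_apply_apply _ _
  have h3 : ∀ k, (Hq.equivL2 q).symm (lp.single 2 k (Hq.equivL2 q f k))
      = f.coeff k • hermHq q k := by
    intro k
    rw [hermHq, ← map_smul, ← lp.single_smul, Hq.equivL2_apply, smul_eq_mul]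
    push_cast
    rfl
  change HasSum (fun k => (Hq.equivL2 q).symm (lp.single 2 k (Hq.equivL2 q f k)))
    ((Hq.equivL2 q).symm (Hq.equivL2 q f)) at h1
  simpa only [h2, h3] using h1

/-- The functional `∑ a_k ĥ_k ↦ ∑ a_k w_k`. -/
lemma exists_functional {w : ℕ → ℂ} (hw : Summable fun k => (q : ℝ) ^ k * ‖w k‖ ^ 2) :
    ∃ A : Hq q →L[ℂ] ℂ, (∀ f : Hq q, HasSum (fun k => f.coeff k * w k) (A f)) ∧
      ‖A‖ ^ 2 ≤ ∑' k, (q : ℝ) ^ k * ‖w k‖ ^ 2 := by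
  have hW : ∀ k, ‖(starRingEnd ℂ) (w k) * (wt q k : ℂ)‖ ^ 2 = (q : ℝ) ^ k * ‖w k‖ ^ 2 := by
    intro k
    rw [norm_mul, mul_pow, Complex.norm_real, Real.norm_eq_abs, sq_abs, wt_sq, RCLike.norm_conj,
      mul_comm]
  -- The Riesz vector of the functional: the conjugate undoes that of the inner product, and
  -- `q^(k/2)` undoes the weight of `equivL2`.
  let W : lp (fun _ : ℕ => ℂ) 2 := ⟨fun k => (starRingEnd ℂ) (w k) * (wt q k : ℂ), by
    refine memℓp_gen ?_
    simp only [ENNReal.toReal_ofNat, Real.rpow_ofNat]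
    exact hw.congr fun k => (hW k).symm⟩
  have hWnorm : ‖W‖ ^ 2 = ∑' k, (q : ℝ) ^ k * ‖w k‖ ^ 2 := by
    have := lp.norm_rpow_eq_tsum (p := 2) (by simp) W
    simp only [ENNReal.toReal_ofNat, Real.rpow_ofNat] at this
    rw [this]
    exact tsum_congr hW
  refine ⟨(innerSL ℂ W).comp (Hq.equivL2 q).toContinuousLinearEquiv.toContinuousLinearMap,
    fun f => ?_, ?_⟩
  · have h := lp.hasSum_inner (𝕜 := ℂ) W (Hq.equivL2 q f)
    have h1 : ∀ k, inner ℂ (W k) (Hq.equivL2 q f k) = f.coeff k * w k := by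
      intro k
      have h0 : (wt q k : ℂ) ≠ 0 := by exact_mod_cast (wt_pos k).ne'
      have hWk : W k = (starRingEnd ℂ) (w k) * (wt q k : ℂ) := rfl
      rw [Hq.equivL2_apply, RCLike.inner_apply, hWk, map_mul, Complex.conj_conj, Complex.conj_ofReal]
      push_cast
      field_simp
    simp only [h1] at h
    exact h
  · rw [← hWnorm]
    have h1 : ‖(innerSL ℂ W).comp
        (Hq.equivL2 q).toContinuousLinearEquiv.toContinuousLinearMap‖ ≤ ‖W‖ := by
      refine ContinuousLinearMap.opNorm_le_bound _ (norm_nonneg _) fun f => ?_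
      refine (norm_inner_le_norm W (Hq.equivL2 q f)).trans_eq ?_
      rw [LinearIsometryEquiv.norm_map]
    gcongr

/-- Evaluation at a point. -/
lemma exists_eval (x : ℝ) : ∃ A : Hq q →L[ℂ] ℂ, ∀ f : Hq q, A f = f x := by
  obtain ⟨A, hA, -⟩ := exists_functional (q := q) (w := fun k => (hermiteHat k x : ℂ)) (by
    refine (summable_pow_mul_hermiteHat_sq q.2.1 q.2.2 x).congr fun n => ?_
    rw [Complex.norm_real, Real.norm_eq_abs, sq_abs])
  exact ⟨A, fun f => (hA f).unique (f.isCoeff.2 x)⟩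

variable (q) in
/-- Evaluation at `x` as a continuous linear functional on `ℋ_q`. -/
def Hq.eval (x : ℝ) : Hq q →L[ℂ] ℂ := Classical.choose (exists_eval x)

lemma Hq.eval_apply (x : ℝ) (f : Hq q) : Hq.eval q x f = f x :=
  Classical.choose_spec (exists_eval x) f

lemma Hq.add_apply (f g : Hq q) (x : ℝ) : (f + g) x = f x + g x := rfl

lemma Hq.smul_apply (c : ℂ) (f : Hq q) (x : ℝ) : (c • f) x = c * f x := rfl

lemma Hq.sum_apply {ι : Type*} (s : Finset ι) (f : ι → Hq q) (x : ℝ) :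
    (∑ i ∈ s, f i) x = ∑ i ∈ s, f i x := by
  rw [← Hq.eval_apply, map_sum]
  simp only [Hq.eval_apply]

/-! ### Polynomials as elements of `ℋ_q` -/

/-- Multiplication by `x` moves `ĥ_k` up and down with factors of at most `√(n+1)` for `k ≤ n`, and
`s^(k±1) ≤ s·s^k`. So the weighted coefficient sum grows by a factor of at most `2s√(n+1)`. For `s =
q^(-1/2)` one has `‖ĥ_k‖ = s^k`, and the sum bounds `‖xⁿ‖`. -/
lemma exists_pow_eq_sum_hermiteHat {s : ℝ} (hs : 1 ≤ s) (n : ℕ) :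
    ∃ a : ℕ → ℝ, (∀ k, 0 ≤ a k) ∧ (∀ k, n < k → a k = 0) ∧
      (∀ x : ℝ, x ^ n = ∑ k ∈ Finset.range (n + 1), a k * hermiteHat k x) ∧
      ∑ k ∈ Finset.range (n + 1), a k * s ^ k ≤ Real.sqrt (n.factorial : ℝ) * (2 * s) ^ n := by
  induction n with
  | zero =>
    refine ⟨fun k => if k = 0 then 1 else 0, fun k => by positivity, fun k hk => by
      simp [hk.ne'], fun x => by simp [hermiteHat], by simp⟩
  | succ n ih =>
    obtain ⟨a, ha0, han, hax, has⟩ := ih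
    let b : ℕ → ℝ := fun k => Real.sqrt k * a (k - 1) + Real.sqrt (k + 1) * a (k + 1)
    have hshift : ∀ F : ℕ → ℝ, ∑ k ∈ Finset.range (n + 1 + 1), b k * F k
        = ∑ k ∈ Finset.range (n + 1),
          a k * (Real.sqrt (k + 1) * F (k + 1) + Real.sqrt k * F (k - 1)) := by
      intro F
      have h1 : ∑ k ∈ Finset.range (n + 1 + 1), Real.sqrt k * a (k - 1) * F k
          = ∑ k ∈ Finset.range (n + 1), a k * (Real.sqrt (k + 1) * F (k + 1)) := by
        rw [Finset.sum_range_succ']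
        simp only [Nat.cast_zero, Real.sqrt_zero, zero_mul, add_zero, Nat.add_sub_cancel]
        refine Finset.sum_congr rfl fun k _ => ?_
        push_cast
        ring
      have h2 : ∑ k ∈ Finset.range (n + 1 + 1), Real.sqrt (k + 1) * a (k + 1) * F k
          = ∑ k ∈ Finset.range (n + 1), a k * (Real.sqrt k * F (k - 1)) := by
        rw [Finset.sum_range_succ, Finset.sum_range_succ, Finset.sum_range_succ',
          han (n + 1) (by omega), han (n + 1 + 1) (by omega)]
        simp only [Nat.cast_zero, Real.sqrt_zero, zero_mul, mul_zero, add_zero, Nat.add_sub_cancel]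
        refine Finset.sum_congr rfl fun k _ => ?_
        push_cast
        ring
      simp only [b, add_mul, mul_add, Finset.sum_add_distrib]
      rw [h1, h2]
    refine ⟨b, fun k => by have := ha0 (k - 1); have := ha0 (k + 1); positivity, fun k hk => ?_,
      fun x => ?_, ?_⟩
    · simp only [b]
      rw [han (k - 1) (by omega), han (k + 1) (by omega)]
      simp
    · rw [hshift (fun k => hermiteHat k x), pow_succ', hax, Finset.mul_sum]
      refine Finset.sum_congr rfl fun k _ => ?_
      rw [← mul_hermiteHat]
      ring
    · rw [hshift (fun k => s ^ k)]
      have h1 : ∀ k ∈ Finset.range (n + 1),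
          a k * (Real.sqrt (k + 1) * s ^ (k + 1) + Real.sqrt k * s ^ (k - 1))
            ≤ Real.sqrt (n + 1) * (2 * s) * (a k * s ^ k) := by
        intro k hk
        have hk' : (k : ℝ) ≤ n := by
          have := Finset.mem_range.1 hk
          exact_mod_cast (by omega : k ≤ n)
        have h2 : Real.sqrt (k + 1) ≤ Real.sqrt (n + 1) := Real.sqrt_le_sqrt (by linarith)
        have h3 : Real.sqrt k ≤ Real.sqrt (n + 1) := Real.sqrt_le_sqrt (by linarith)
        have h4 : s ^ (k - 1) ≤ s ^ (k + 1) := pow_le_pow_right₀ hs (by omega)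
        have h5 : Real.sqrt k * s ^ (k - 1) ≤ Real.sqrt (n + 1) * s ^ (k + 1) := by gcongr
        have h6 : Real.sqrt (k + 1) * s ^ (k + 1) ≤ Real.sqrt (n + 1) * s ^ (k + 1) := by gcongr
        calc _ ≤ a k * (Real.sqrt (n + 1) * s ^ (k + 1) + Real.sqrt (n + 1) * s ^ (k + 1)) := by
              have := ha0 k
              gcongr
          _ = _ := by ring
      refine (Finset.sum_le_sum h1).trans ?_
      rw [← Finset.mul_sum, sqrt_factorial_succ]
      calc _ ≤ Real.sqrt (n + 1) * (2 * s) * (Real.sqrt (n.factorial : ℝ) * (2 * s) ^ n) := by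
            gcongr
        _ = _ := by ring

lemma exists_toHq (p : Polynomial ℝ) : ∃ f : Hq q, ∀ x : ℝ, f x = (p.eval x : ℝ) := by
  induction p using Polynomial.induction_on' with
  | add p r hp hr =>
    obtain ⟨f, hf⟩ := hp
    obtain ⟨g, hg⟩ := hr
    exact ⟨f + g, fun x => by rw [Hq.add_apply, hf, hg]; simp⟩
  | monomial n c =>
    obtain ⟨a, -, -, ha, -⟩ := exists_pow_eq_sum_hermiteHat (le_refl 1) n
    refine ⟨(c : ℂ) • ∑ k ∈ Finset.range (n + 1), (a k : ℂ) • hermHq q k, fun x => ?_⟩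
    simp only [Hq.smul_apply, Hq.sum_apply, hermHq_apply, Polynomial.eval_monomial, ha]
    push_cast
    rfl

variable (q) in
/-- A real polynomial as an element of `ℋ_q`. -/
def toHq (p : Polynomial ℝ) : Hq q := Classical.choose (exists_toHq p)

lemma toHq_apply (p : Polynomial ℝ) (x : ℝ) : toHq q p x = (p.eval x : ℝ) :=
  Classical.choose_spec (exists_toHq p) x

lemma toHq_add (p r : Polynomial ℝ) : toHq q (p + r) = toHq q p + toHq q r :=
  DFunLike.ext _ _ fun x => by simp [toHq_apply, Hq.add_apply]

lemma toHq_C_mul (c : ℝ) (p : Polynomial ℝ) : toHq q (Polynomial.C c * p) = (c : ℂ) • toHq q p :=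
  DFunLike.ext _ _ fun x => by
    rw [Hq.smul_apply, toHq_apply, toHq_apply]; simp

lemma toHq_sum {ι : Type*} (s : Finset ι) (p : ι → Polynomial ℝ) :
    toHq q (∑ i ∈ s, p i) = ∑ i ∈ s, toHq q (p i) :=
  DFunLike.ext _ _ fun x => by simp [toHq_apply, Hq.sum_apply, Polynomial.eval_finsetSum]

lemma toHq_sub (p r : Polynomial ℝ) : toHq q (p - r) = toHq q p - toHq q r := by
  rw [eq_sub_iff_add_eq, ← toHq_add, sub_add_cancel]

lemma toHq_hermR (k : ℕ) :
    toHq q (hermR k) = (Real.sqrt (k.factorial : ℝ) : ℂ) • hermHq q k :=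
  DFunLike.ext _ _ fun x => by
    have h : Real.sqrt (k.factorial : ℝ) ≠ 0 := (Real.sqrt_pos.2 (by positivity)).ne'
    rw [toHq_apply, Hq.smul_apply, hermHq_apply, hermiteHat_eq, ← Complex.ofReal_mul,
      mul_div_cancel₀ _ h]

lemma inv_wt (k : ℕ) : (wt q k)⁻¹ = ((Real.sqrt (q : ℝ))⁻¹) ^ k := by
  rw [wt, inv_pow, Real.sqrt_eq_rpow, Real.sqrt_eq_rpow, ← Real.rpow_natCast, ← Real.rpow_natCast,
    ← Real.rpow_mul q.2.1.le, ← Real.rpow_mul q.2.1.le, mul_comm]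

lemma norm_toHq_X_pow_le (n : ℕ) :
    ‖toHq q (Polynomial.X ^ n)‖
      ≤ Real.sqrt (n.factorial : ℝ) * (2 * (Real.sqrt (q : ℝ))⁻¹) ^ n := by
  have hs : 1 ≤ (Real.sqrt (q : ℝ))⁻¹ :=
    (one_le_inv₀ (Real.sqrt_pos.2 q.2.1)).2 (Real.sqrt_le_one.2 q.2.2.le)
  obtain ⟨a, ha0, -, hax, has⟩ := exists_pow_eq_sum_hermiteHat hs n
  have h : toHq q (Polynomial.X ^ n)
      = ∑ k ∈ Finset.range (n + 1), (a k : ℂ) • hermHq q k := by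
    refine DFunLike.ext _ _ fun x => ?_
    simp only [toHq_apply, Polynomial.eval_pow, Polynomial.eval_X, Hq.smul_apply, Hq.sum_apply,
      hermHq_apply, hax]
    push_cast
    rfl
  rw [h]
  refine (norm_sum_le _ _).trans (le_trans (le_of_eq ?_) has)
  refine Finset.sum_congr rfl fun k _ => ?_
  rw [norm_smul, Complex.norm_real, Real.norm_of_nonneg (ha0 k), norm_hermHq, inv_wt]

/-! ### Gaussian tail integrals of polynomials -/

/-- `∫_t^∞ p(y) φ(y) dy`. -/
def tailInt (p : Polynomial ℝ) (t : ℝ) : ℝ := ∫ y in Set.Ioi t, p.eval y * phi y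

lemma integrable_eval_mul_phi (p : Polynomial ℝ) : Integrable fun y => p.eval y * phi y :=
  (integrable_pdf_mul_eval p).congr (Filter.Eventually.of_forall fun _ => mul_comm _ _)

lemma hasDerivAt_phi (x : ℝ) : HasDerivAt phi (-x * phi x) x := hasDerivAt_pdf x

lemma continuous_phi : Continuous phi :=
  continuous_iff_continuousAt.2 fun x => (hasDerivAt_phi x).continuousAt

lemma tailInt_add (p r : Polynomial ℝ) (t : ℝ) :
    tailInt (p + r) t = tailInt p t + tailInt r t := by
  rw [tailInt, tailInt, tailInt, ← integral_add (integrable_eval_mul_phi p).integrableOn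
    (integrable_eval_mul_phi r).integrableOn]
  simp [add_mul]

lemma tailInt_C_mul (c : ℝ) (p : Polynomial ℝ) (t : ℝ) :
    tailInt (Polynomial.C c * p) t = c * tailInt p t := by
  rw [tailInt, tailInt, ← integral_const_mul]
  simp [mul_assoc]

lemma hasDerivAt_tailInt (p : Polynomial ℝ) (t : ℝ) :
    HasDerivAt (tailInt p) (-(p.eval t * phi t)) t := by
  have hc : Continuous fun y => p.eval y * phi y := p.continuous.mul continuous_phi
  have h1 : tailInt p = fun t => tailInt p 0 - ∫ y in (0 : ℝ)..t, p.eval y * phi y := by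
    funext t
    have := intervalIntegral.integral_interval_add_Ioi (a := 0) (b := t)
      (integrable_eval_mul_phi p).integrableOn (integrable_eval_mul_phi p).integrableOn
    rw [tailInt, tailInt, ← this]
    ring
  rw [h1]
  have h2 := intervalIntegral.integral_hasDerivAt_right (hc.intervalIntegrable 0 t)
    hc.aestronglyMeasurable.stronglyMeasurableAtFilter hc.continuousAt
  simpa using h2.const_sub (tailInt p 0)

/-- The operator `p ↦ p' - x p`, for which `(p φ)' = (p' - x p) φ`. -/
def gaussDeriv (p : Polynomial ℝ) : Polynomial ℝ := Polynomial.derivative p - Polynomial.X * p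

lemma hasDerivAt_eval_mul_phi (p : Polynomial ℝ) (x : ℝ) :
    HasDerivAt (fun y => p.eval y * phi y) ((gaussDeriv p).eval x * phi x) x := by
  refine ((p.hasDerivAt x).mul (hasDerivAt_phi x)).congr_deriv ?_
  simp only [gaussDeriv, Polynomial.eval_sub, Polynomial.eval_mul, Polynomial.eval_X]
  ring

lemma tailInt_gaussDeriv (p : Polynomial ℝ) (t : ℝ) :
    tailInt (gaussDeriv p) t = -(p.eval t * phi t) := by
  -- A function that is integrable together with its derivative vanishes at infinity.
  have hlim : Filter.Tendsto (fun y => p.eval y * phi y) Filter.atTop (nhds 0) :=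
    tendsto_zero_of_hasDerivAt_of_integrableOn_Ioi (a := t)
      (fun x _ => hasDerivAt_eval_mul_phi p x) (integrable_eval_mul_phi _).integrableOn
      (integrable_eval_mul_phi _).integrableOn
  have := integral_Ioi_of_hasDerivAt_of_tendsto' (a := t)
    (fun x _ => hasDerivAt_eval_mul_phi p x) (integrable_eval_mul_phi _).integrableOn hlim
  rw [tailInt, this, zero_sub]

lemma hermR_succ_eq (k : ℕ) : hermR (k + 1) = Polynomial.C (-1) * gaussDeriv (hermR k) := by
  rw [hermR_succ, gaussDeriv]; simp

lemma tailInt_hermR_succ (k : ℕ) (t : ℝ) :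
    tailInt (hermR (k + 1)) t = (hermR k).eval t * phi t := by
  rw [hermR_succ_eq, tailInt_C_mul, tailInt_gaussDeriv]; ring

/-- From `|ĥ_k| ≤ (1 + ĥ_k²)/2` and the normalization of `ĥ_k` in `L²(γ)`. -/
lemma integral_abs_hermiteHat_le (k : ℕ) : ∫ y, |hermiteHat k y| * phi y ≤ 1 := by
  have h0 : ∀ y, 0 ≤ phi y := fun y => gaussianPDFReal_nonneg 0 1 y
  have hP : (fun y => ((1 / 2 : ℝ) * (1 + hermiteHat k y * hermiteHat k y)) * phi y)
      = fun y => (Polynomial.C (1 / 2 : ℝ) * (1 + Polynomial.C ((k.factorial : ℝ)⁻¹) *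
        (hermR k * hermR k))).eval y * phi y := by
    funext y
    rw [hermiteHat_eq, div_mul_div_comm, Real.mul_self_sqrt (by positivity)]
    simp only [Polynomial.eval_mul, Polynomial.eval_C, Polynomial.eval_add, Polynomial.eval_one]
    ring
  have hI := integrable_eval_mul_phi (Polynomial.C (1 / 2 : ℝ) *
    (1 + Polynomial.C ((k.factorial : ℝ)⁻¹) * (hermR k * hermR k)))
  rw [← hP] at hI
  have h1 : ∫ y, ((1 / 2 : ℝ) * (1 + hermiteHat k y * hermiteHat k y)) * phi y = 1 := by
    have h2 := integral_gaussianReal_eq_integral_smul (μ := 0) one_ne_zero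
      (f := fun y => (1 / 2 : ℝ) * (1 + hermiteHat k y * hermiteHat k y))
    have h3 : Integrable (fun y => hermiteHat k y * hermiteHat k y) (gaussianReal 0 1) := by
      refine ((integrable_eval (hermR k * hermR k)).mul_const ((k.factorial : ℝ)⁻¹)).congr
        (Filter.Eventually.of_forall fun y => ?_)
      simp only [hermiteHat_eq]
      rw [div_mul_div_comm, Real.mul_self_sqrt (by positivity), Polynomial.eval_mul, div_eq_mul_inv]
    rw [integral_const_mul, integral_add (integrable_const _) h3, integral_hermiteHat] at h2
    simp only [smul_eq_mul] at h2
    simp only [phi, mul_comm _ (gaussianPDFReal 0 1 _)]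
    rw [← h2]
    simp
    norm_num
  rw [← h1]
  refine integral_mono_of_nonneg (Filter.Eventually.of_forall fun y => ?_) hI
    (Filter.Eventually.of_forall fun y => ?_)
  · exact mul_nonneg (abs_nonneg _) (h0 y)
  · refine mul_le_mul_of_nonneg_right ?_ (h0 y)
    nlinarith [sq_abs (hermiteHat k y), sq_nonneg (|hermiteHat k y| - 1)]

lemma integrable_hermiteHat_mul_phi (k : ℕ) : Integrable fun y => hermiteHat k y * phi y := by
  refine ((integrable_eval_mul_phi (hermR k)).const_mul
    (Real.sqrt (k.factorial : ℝ))⁻¹).congr (Filter.Eventually.of_forall fun y => ?_)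
  simp only [hermiteHat_eq]
  ring

lemma integrable_abs_hermiteHat_mul_phi (k : ℕ) :
    Integrable fun y => |hermiteHat k y| * phi y := by
  refine (integrable_hermiteHat_mul_phi k).abs.congr (Filter.Eventually.of_forall fun y => ?_)
  simp only [abs_mul, abs_of_nonneg (gaussianPDFReal_nonneg 0 1 y), phi]

lemma setIntegral_abs_hermiteHat_le (k : ℕ) (s : Set ℝ) :
    ∫ y in s, |hermiteHat k y| * phi y ≤ 1 :=
  (setIntegral_le_integral (integrable_abs_hermiteHat_mul_phi k)
    (Filter.Eventually.of_forall fun y =>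
      mul_nonneg (abs_nonneg _) (gaussianPDFReal_nonneg 0 1 y))).trans
    (integral_abs_hermiteHat_le k)

lemma tailInt_hermR_eq (k : ℕ) (t : ℝ) :
    tailInt (hermR k) t
      = Real.sqrt (k.factorial : ℝ) * ∫ y in Set.Ioi t, hermiteHat k y * phi y := by
  have h : Real.sqrt (k.factorial : ℝ) ≠ 0 := (Real.sqrt_pos.2 (by positivity)).ne'
  rw [tailInt, ← integral_const_mul]
  refine integral_congr_ae (Filter.Eventually.of_forall fun y => ?_)
  simp only [hermiteHat_eq]
  field_simp

lemma abs_tailInt_hermR_le (k : ℕ) (t : ℝ) :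
    |tailInt (hermR k) t| ≤ Real.sqrt (k.factorial : ℝ) := by
  rw [tailInt_hermR_eq, abs_mul, abs_of_nonneg (Real.sqrt_nonneg _)]
  refine mul_le_of_le_one_right (Real.sqrt_nonneg _) ?_
  refine (abs_integral_le_integral_abs).trans (le_trans (le_of_eq ?_)
    (setIntegral_abs_hermiteHat_le k (Set.Ioi t)))
  refine integral_congr_ae (Filter.Eventually.of_forall fun y => ?_)
  simp only [abs_mul, abs_of_nonneg (gaussianPDFReal_nonneg 0 1 y), phi]

/-! ### Taylor expansion of the tail integrals -/

/-- The derivative `-h_k φ` is again minus a tail integral, because `h_{k+1} φ = -(h_k φ)'`. So all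
Taylor coefficients are tail integrals of Hermite polynomials. -/
lemma deriv_tailInt_hermR (k : ℕ) :
    deriv (tailInt (hermR k)) = fun t => -tailInt (hermR (k + 1)) t := by
  funext t
  rw [(hasDerivAt_tailInt _ t).deriv, tailInt_hermR_succ]

lemma iteratedDeriv_tailInt_hermR (k n : ℕ) :
    iteratedDeriv n (tailInt (hermR k)) = fun t => (-1) ^ n * tailInt (hermR (k + n)) t := by
  induction n with
  | zero => simp
  | succ n ih =>
    rw [iteratedDeriv_succ, ih]
    funext t
    rw [deriv_const_mul _ (hasDerivAt_tailInt _ t).differentiableAt, deriv_tailInt_hermR]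
    rw [pow_succ, add_assoc]; ring

lemma contDiff_tailInt_hermR (k n : ℕ) : ContDiff ℝ n (tailInt (hermR k)) := by
  refine contDiff_of_differentiable_iteratedDeriv (n := (n : ℕ∞)) fun m _ => ?_
  rw [iteratedDeriv_tailInt_hermR]
  exact fun t => (hasDerivAt_tailInt _ t).differentiableAt.const_mul _

/-- Since `(k+n)! ≤ 2^(k+n) k! n!`, the square is at most a constant times `(2x²)ⁿ / n!`. -/
lemma tendsto_sqrt_factorial_mul_pow_div (k : ℕ) (x : ℝ) :
    Filter.Tendsto (fun n : ℕ => Real.sqrt ((k + n).factorial : ℝ) * |x| ^ n / n.factorial)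
      Filter.atTop (nhds 0) := by
  have h1 : Filter.Tendsto (fun n : ℕ => Real.sqrt ((2 ^ k * k.factorial : ℝ) *
      ((2 * x ^ 2) ^ n / n.factorial))) Filter.atTop (nhds 0) := by
    have := ((FloorSemiring.tendsto_pow_div_factorial_atTop (2 * x ^ 2)).const_mul
      (2 ^ k * k.factorial : ℝ)).sqrt
    simpa using this
  refine squeeze_zero (fun n => by positivity) (fun n => ?_) h1
  refine Real.le_sqrt_of_sq_le ?_
  have hf : ((k + n).factorial : ℝ) ≤ 2 ^ (k + n) * (k.factorial * n.factorial) := by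
    rw [← Nat.add_choose_mul_factorial_mul_factorial k n]
    have := Nat.choose_le_two_pow (k + n) n
    push_cast
    rw [mul_assoc]
    gcongr
    exact_mod_cast this
  have hn : (0 : ℝ) < n.factorial := by positivity
  rw [div_pow, mul_pow, Real.sq_sqrt (by positivity), ← pow_mul, mul_comm n 2, pow_mul, sq_abs,
    div_le_iff₀ (by positivity)]
  calc _ ≤ 2 ^ (k + n) * (k.factorial * n.factorial) * (x ^ 2) ^ n := by gcongr
    _ = _ := by
      field_simp
      ring

/-- Lagrange's remainder is controlled by the bound `√((k+n)!)`, which is uniform in the endpoint of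
the tail integral, so the Taylor series at `0` converges on the whole line. -/
lemma tendsto_taylor_tailInt_hermR (k : ℕ) (t : ℝ) :
    Filter.Tendsto (fun N => ∑ n ∈ Finset.range N,
      (-t) ^ n / n.factorial * tailInt (hermR (k + n)) 0) Filter.atTop
      (nhds (tailInt (hermR k) t)) := by
  rcases eq_or_ne 0 t with rfl | ht
  · refine tendsto_const_nhds.congr' ?_
    filter_upwards [Filter.eventually_ge_atTop 1] with N hN
    obtain ⟨M, rfl⟩ : ∃ M, N = M + 1 := ⟨N - 1, by omega⟩
    rw [Finset.sum_range_succ']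
    simp
  rw [← Filter.tendsto_add_atTop_iff_nat 1, tendsto_iff_norm_sub_tendsto_zero]
  have hlim := (Filter.tendsto_add_atTop_iff_nat 1).2 (tendsto_sqrt_factorial_mul_pow_div k t)
  refine squeeze_zero (fun _ => norm_nonneg _) (fun N => ?_) hlim
  obtain ⟨x', -, hx'⟩ := taylor_mean_remainder_lagrange_iteratedDeriv (n := N) ht
    (contDiff_tailInt_hermR k (N + 1)).contDiffOn
  rw [taylor_within_apply] at hx'
  have hsum : ∑ n ∈ Finset.range (N + 1), ((n.factorial : ℝ)⁻¹ * (t - 0) ^ n) •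
      iteratedDerivWithin n (tailInt (hermR k)) (Set.uIcc 0 t) 0
      = ∑ n ∈ Finset.range (N + 1), (-t) ^ n / n.factorial * tailInt (hermR (k + n)) 0 := by
    refine Finset.sum_congr rfl fun n _ => ?_
    rw [iteratedDerivWithin_eq_iteratedDeriv (uniqueDiffOn_uIcc ht)
      (contDiff_tailInt_hermR k n).contDiffAt Set.left_mem_uIcc, iteratedDeriv_tailInt_hermR,
      neg_pow t, smul_eq_mul]
    ring
  rw [hsum] at hx'
  rw [norm_sub_rev, Real.norm_eq_abs, hx', iteratedDeriv_tailInt_hermR, sub_zero, abs_div, abs_mul,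
    abs_mul, abs_pow, abs_neg, abs_one, one_pow, one_mul, abs_pow, Nat.abs_cast]
  gcongr
  exact abs_tailInt_hermR_le _ _

/-! ### The operators `T_ρ` and `T⁽ⁿ⁾` on `ℋ_q` -/

/-- The value of the functional `f ↦ (-1)ⁿ ∫_0^∞ (f φ)⁽ⁿ⁾` at `ĥ_k`. -/
def coeffWeight (n k : ℕ) : ℝ := tailInt (hermR (k + n)) 0 / Real.sqrt (k.factorial : ℝ)

/-- The squared weight is at most `(k+n)!/k! = n! · C(k+n, n)`. Summed against `q^k` this gives `n!
(1-q)^(-n-1)`, the bound for the squared norm of the functional. -/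
lemma coeffWeight_sq_le (n k : ℕ) :
    (q : ℝ) ^ k * ‖(coeffWeight n k : ℂ)‖ ^ 2
      ≤ n.factorial * (((k + n).choose n : ℝ) * (q : ℝ) ^ k) := by
  have hq := q.2.1
  have h1 : ‖(coeffWeight n k : ℂ)‖ ^ 2 ≤ (k + n).factorial / k.factorial := by
    rw [Complex.norm_real, Real.norm_eq_abs, sq_abs, coeffWeight, div_pow,
      Real.sq_sqrt (by positivity), ← sq_abs]
    gcongr
    have := pow_le_pow_left₀ (abs_nonneg _) (abs_tailInt_hermR_le (k + n) 0) 2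
    rwa [Real.sq_sqrt (by positivity)] at this
  have h2 : ((k + n).factorial : ℝ) = (k + n).choose n * (k.factorial * n.factorial) := by
    rw [← Nat.add_choose_mul_factorial_mul_factorial k n]
    push_cast
    ring
  rw [h2] at h1
  have hk : (0 : ℝ) < k.factorial := by positivity
  calc (q : ℝ) ^ k * ‖(coeffWeight n k : ℂ)‖ ^ 2
      ≤ (q : ℝ) ^ k * ((k + n).choose n * (k.factorial * n.factorial) / k.factorial) := by gcongr
    _ = _ := by field_simp

lemma exists_coeffFunctional (n : ℕ) : ∃ A : Hq q →L[ℂ] ℂ,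
    (∀ f : Hq q, HasSum (fun k => f.coeff k * (coeffWeight n k : ℂ)) (A f)) ∧
      ‖A‖ ^ 2 ≤ n.factorial * (1 / (1 - (q : ℝ)) ^ (n + 1)) := by
  have hq := q.2
  have hs := (hasSum_choose_mul_geometric_of_norm_lt_one n (r := (q : ℝ)) (by
    rw [Real.norm_of_nonneg hq.1.le]; exact hq.2)).mul_left (n.factorial : ℝ)
  have hw : Summable fun k => (q : ℝ) ^ k * ‖(coeffWeight n k : ℂ)‖ ^ 2 :=
    Summable.of_nonneg_of_le (fun k => by have := hq.1; positivity) (coeffWeight_sq_le n) hs.summable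
  obtain ⟨A, hA, hA'⟩ := exists_functional hw
  exact ⟨A, hA, hA'.trans ((hw.tsum_le_tsum (coeffWeight_sq_le n) hs.summable).trans_eq hs.tsum_eq)⟩

variable (q) in
/-- The functional `f ↦ (-1)ⁿ ∫_0^∞ (f φ)⁽ⁿ⁾` on `ℋ_q`. -/
def coeffFunctional (n : ℕ) : Hq q →L[ℂ] ℂ := Classical.choose (exists_coeffFunctional n)

lemma hasSum_coeffFunctional (n : ℕ) (f : Hq q) :
    HasSum (fun k => f.coeff k * (coeffWeight n k : ℂ)) (coeffFunctional q n f) :=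
  (Classical.choose_spec (exists_coeffFunctional n)).1 f

lemma norm_coeffFunctional_sq_le (n : ℕ) :
    ‖coeffFunctional q n‖ ^ 2 ≤ n.factorial * (1 / (1 - (q : ℝ)) ^ (n + 1)) :=
  (Classical.choose_spec (exists_coeffFunctional n)).2

lemma coeffFunctional_hermHq (n k : ℕ) : coeffFunctional q n (hermHq q k) = coeffWeight n k := by
  have h := hasSum_coeffFunctional n (hermHq q k)
  rw [coeff_hermHq] at h
  refine h.unique ?_
  convert hasSum_single (f := fun j => (Pi.single k 1 : ℕ → ℂ) j * (coeffWeight n j : ℂ)) k ?_ using 1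
  · simp
  · intro j hj; simp [hj]

lemma coeffFunctional_toHq_hermR (n k : ℕ) :
    coeffFunctional q n (toHq q (hermR k)) = (tailInt (hermR (k + n)) 0 : ℝ) := by
  have h : Real.sqrt (k.factorial : ℝ) ≠ 0 := (Real.sqrt_pos.2 (by positivity)).ne'
  rw [toHq_hermR, map_smul, coeffFunctional_hermHq, smul_eq_mul, coeffWeight,
    ← Complex.ofReal_mul, mul_div_cancel₀ _ h]

variable (q) in
/-- The operator `T⁽ⁿ⁾` on `ℋ_q`. -/
def coeffOp (n : ℕ) : Hq q →L[ℂ] Hq q :=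
  (coeffFunctional q n).smulRight (((n.factorial : ℝ)⁻¹ : ℂ) • toHq q (Polynomial.X ^ n))

lemma coeffOp_apply (n : ℕ) (f : Hq q) (x : ℝ) :
    coeffOp q n f x = coeffFunctional q n f * ((n.factorial : ℂ)⁻¹ * (x : ℂ) ^ n) := by
  rw [coeffOp, ContinuousLinearMap.smulRight_apply, Hq.smul_apply, Hq.smul_apply, toHq_apply]
  simp

/-- The functional and the vector `xⁿ` each contribute `√(n!)`, and the factor `1/n!` cancels both.
-/
lemma norm_coeffOp_le (n : ℕ) :
    ‖coeffOp q n‖ ≤ (Real.sqrt (1 - q))⁻¹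
      * (2 * (Real.sqrt (q : ℝ))⁻¹ * (Real.sqrt (1 - q))⁻¹) ^ n := by
  have hq : 0 < 1 - (q : ℝ) := sub_pos.2 q.2.2
  have hA : ‖coeffFunctional q n‖
      ≤ Real.sqrt (n.factorial : ℝ) * (Real.sqrt (1 - q))⁻¹ ^ (n + 1) := by
    refine le_of_sq_le_sq ?_ (by positivity)
    refine (norm_coeffFunctional_sq_le n).trans_eq ?_
    rw [mul_pow, Real.sq_sqrt (by positivity), ← pow_mul, mul_comm (n + 1) 2, pow_mul, inv_pow,
      Real.sq_sqrt hq.le, one_div, inv_pow]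
  have hn : (0 : ℝ) < n.factorial := by positivity
  have hX := norm_toHq_X_pow_le (q := q) n
  rw [coeffOp, ContinuousLinearMap.norm_smulRight_apply, norm_smul]
  have h1 : ‖(((n.factorial : ℝ)⁻¹ : ℂ))‖ = (n.factorial : ℝ)⁻¹ := by simp
  rw [h1]
  have hsq : Real.sqrt (n.factorial : ℝ) * Real.sqrt (n.factorial : ℝ) = n.factorial :=
    Real.mul_self_sqrt hn.le
  calc _ ≤ Real.sqrt (n.factorial : ℝ) * (Real.sqrt (1 - q))⁻¹ ^ (n + 1) *
        ((n.factorial : ℝ)⁻¹ *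
          (Real.sqrt (n.factorial : ℝ) * (2 * (Real.sqrt (q : ℝ))⁻¹) ^ n)) := by gcongr
    _ = (Real.sqrt (n.factorial : ℝ) * Real.sqrt (n.factorial : ℝ)) * (n.factorial : ℝ)⁻¹ *
        ((Real.sqrt (1 - q))⁻¹ * (2 * (Real.sqrt (q : ℝ))⁻¹ * (Real.sqrt (1 - q))⁻¹) ^ n) := by
          rw [mul_pow (2 * (Real.sqrt (q : ℝ))⁻¹), pow_succ]; ring
    _ = _ := by rw [hsq, mul_inv_cancel₀ hn.ne', one_mul]

lemma phi_eq (x : ℝ) : phi x = (Real.sqrt (2 * Real.pi))⁻¹ * Real.exp (-(1 / 2) * x ^ 2) := by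
  simp only [phi, gaussianPDFReal, NNReal.coe_one, mul_one, sub_zero]
  congr 2
  ring

lemma tailInt_one_zero : tailInt 1 0 = 1 / 2 := by
  have h : Real.sqrt (2 * Real.pi) ≠ 0 := (Real.sqrt_pos.2 (by positivity)).ne'
  rw [tailInt]
  simp only [Polynomial.eval_one, one_mul, phi_eq]
  rw [integral_const_mul, integral_gaussian_Ioi, show Real.pi / (1 / 2) = 2 * Real.pi by ring,
    ← mul_div_assoc, inv_mul_cancel₀ h]

variable (q) in
/-- The expansion `T_ρ = ∑ ρⁿ T⁽ⁿ⁾` as a perturbation of the rank one operator `T⁽⁰⁾`. -/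
def maPerturbation : RankOnePerturbation (Hq q) where
  P := coeffOp q
  ℓ := coeffFunctional q 0
  ev := Hq.eval q 0
  e := toHq q 1
  A := (Real.sqrt (1 - q))⁻¹
  D := 2 * (Real.sqrt (q : ℝ))⁻¹ * (Real.sqrt (1 - q))⁻¹
  P_zero := by
    rw [coeffOp]
    simp
  ℓ_e := by
    have h := coeffFunctional_toHq_hermR (q := q) 0 0
    have h0 : hermR 0 = 1 := by simp [hermR]
    simp only [add_zero, h0, tailInt_one_zero] at h
    rw [h]
    simp
  ev_e := by rw [Hq.eval_apply, toHq_apply]; simp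
  ev_P n h := by rw [Hq.eval_apply, coeffOp_apply]; simp
  norm_P_le := norm_coeffOp_le
  A_nonneg := by positivity
  D_pos := by
    have h1 := Real.sqrt_pos.2 q.2.1
    have h2 := Real.sqrt_pos.2 (sub_pos.2 q.2.2)
    positivity

/-! ### Identification of the operator series with `T_ρ` -/

lemma maOp_hermHq (ρ x : ℝ) (k : ℕ) :
    maOp ρ (hermHq q k) x = (∫ y in Set.Ioi (-(ρ * x)), hermiteHat k y * phi y : ℝ) := by
  rw [maOp, ← integral_complex_ofReal]
  refine integral_congr_ae (Filter.Eventually.of_forall fun y => ?_)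
  simp [hermHq_apply]

/-- At the point `x` the `n`-th term of the series is, up to the factor `1/√(k!)`, the `n`-th Taylor
term of the tail integral of `h_k` at the endpoint `-ρx`. -/
lemma apply_hermHq_of_hasSum {ρ : ℝ} {T : Hq q →L[ℂ] Hq q}
    (hT : HasSum (fun n => (ρ : ℂ) ^ n • coeffOp q n) T) (k : ℕ) (x : ℝ) :
    T (hermHq q k) x = maOp ρ (hermHq q k) x := by
  have hk : Real.sqrt (k.factorial : ℝ) ≠ 0 := (Real.sqrt_pos.2 (by positivity)).ne'
  have h1 := ((Hq.eval q x).comp (ContinuousLinearMap.apply ℂ (Hq q) (hermHq q k))).hasSum hT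
  have h2 : ∀ n, ((Hq.eval q x).comp (ContinuousLinearMap.apply ℂ (Hq q) (hermHq q k)))
      ((ρ : ℂ) ^ n • coeffOp q n)
      = (((Real.sqrt (k.factorial : ℝ))⁻¹ *
        ((-(-(ρ * x))) ^ n / n.factorial * tailInt (hermR (k + n)) 0) : ℝ) : ℂ) := by
    intro n
    change Hq.eval q x (((ρ : ℂ) ^ n • coeffOp q n) (hermHq q k)) = _
    rw [smul_apply, map_smul, Hq.eval_apply, coeffOp_apply, coeffFunctional_hermHq, coeffWeight,
      neg_neg, smul_eq_mul]
    push_cast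
    ring
  simp only [h2] at h1
  have h3 := h1.tendsto_sum_nat
  have h4 : ((Hq.eval q x).comp (ContinuousLinearMap.apply ℂ (Hq q) (hermHq q k))) T
      = T (hermHq q k) x := Hq.eval_apply x _
  rw [h4] at h3
  have h5 := ((tendsto_taylor_tailInt_hermR k (-(ρ * x))).const_mul
    (Real.sqrt (k.factorial : ℝ))⁻¹).ofReal
  have h6 := tendsto_nhds_unique h3 (h5.congr fun N => by
    rw [Finset.mul_sum]
    push_cast
    rfl)
  rw [h6, maOp_hermHq, tailInt_hermR_eq, inv_mul_cancel_left₀ hk]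

lemma summable_norm_coeff (f : Hq q) : Summable fun k => ‖f.coeff k‖ := by
  have hq := q.2
  have h1 := f.isCoeff.1
  have h2 := summable_geometric_of_lt_one hq.1.le hq.2
  refine Summable.of_nonneg_of_le (fun _ => norm_nonneg _) (fun k => ?_) (h1.add h2)
  have hk : 0 < (q : ℝ) ^ k := pow_pos hq.1 k
  -- Completing the square gives `|a| ≤ |a|² q^(-k) + q^k`.
  have h3 : 0 ≤ ((q : ℝ) ^ k)⁻¹ * ((‖f.coeff k‖ - (q : ℝ) ^ k) ^ 2 + ‖f.coeff k‖ * (q : ℝ) ^ k) := by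
    have := norm_nonneg (f.coeff k)
    positivity
  have h4 : ((q : ℝ) ^ k)⁻¹ * ((‖f.coeff k‖ - (q : ℝ) ^ k) ^ 2 + ‖f.coeff k‖ * (q : ℝ) ^ k)
      = ‖f.coeff k‖ ^ 2 * ((q : ℝ) ^ k)⁻¹ + (q : ℝ) ^ k - ‖f.coeff k‖ := by
    field_simp
    ring
  linarith

/-- Sum and integral may be exchanged since `∫ |ĥ_k| φ ≤ 1` and the coefficients are absolutely
summable. -/
lemma hasSum_maOp (ρ x : ℝ) (f : Hq q) :
    HasSum (fun k => f.coeff k * maOp ρ (hermHq q k) x) (maOp ρ f x) := by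
  set s := Set.Ioi (-(ρ * x)) with hs
  have hint : ∀ k, Integrable (fun y => f.coeff k * (hermiteHat k y : ℂ) * (phi y : ℂ))
      (volume.restrict s) := by
    intro k
    refine (((integrable_hermiteHat_mul_phi k).ofReal (𝕜 := ℂ)).const_mul
      (f.coeff k)).restrict.congr (Filter.Eventually.of_forall fun y => ?_)
    simp [mul_assoc]
  have hnorm : ∀ k, ∫ y in s, ‖f.coeff k * (hermiteHat k y : ℂ) * (phi y : ℂ)‖
      = ‖f.coeff k‖ * ∫ y in s, |hermiteHat k y| * phi y := by
    intro k
    rw [← integral_const_mul]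
    refine integral_congr_ae (Filter.Eventually.of_forall fun y => ?_)
    have : 0 ≤ phi y := gaussianPDFReal_nonneg 0 1 y
    simp [abs_of_nonneg this, mul_assoc]
  have hsum : Summable fun k => ∫ y in s, ‖f.coeff k * (hermiteHat k y : ℂ) * (phi y : ℂ)‖ := by
    refine Summable.of_nonneg_of_le (fun k => integral_nonneg fun _ => norm_nonneg _)
      (fun k => ?_) (summable_norm_coeff f)
    rw [hnorm]
    exact mul_le_of_le_one_right (norm_nonneg _) (setIntegral_abs_hermiteHat_le k s)
  have h := hasSum_integral_of_summable_integral_norm hint hsum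
  have h1 : ∀ k, ∫ y in s, f.coeff k * (hermiteHat k y : ℂ) * (phi y : ℂ)
      = f.coeff k * maOp ρ (hermHq q k) x := by
    intro k
    rw [maOp, ← integral_const_mul]
    simp only [hermHq_apply, mul_assoc, hs]
  have h2 : ∫ y in s, ∑' k, f.coeff k * (hermiteHat k y : ℂ) * (phi y : ℂ) = maOp ρ f x := by
    rw [maOp]
    refine integral_congr_ae (Filter.Eventually.of_forall fun y => ?_)
    exact ((f.isCoeff.2 y).mul_right (phi y : ℂ)).tsum_eq
  simpa only [h1, h2] using h

/-- The power series `∑ ρⁿ T⁽ⁿ⁾` represents `T_ρ`. -/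
theorem apply_eq_maOp_of_hasSum {ρ : ℝ} {T : Hq q →L[ℂ] Hq q}
    (hT : HasSum (fun n => (ρ : ℂ) ^ n • coeffOp q n) T) (f : Hq q) (x : ℝ) :
    T f x = maOp ρ f x := by
  have h1 := ((Hq.eval q x).comp T).hasSum f.hasSum_coeff
  have h2 : ∀ k, ((Hq.eval q x).comp T) (f.coeff k • hermHq q k)
      = f.coeff k * maOp ρ (hermHq q k) x := by
    intro k
    rw [map_smul, ← apply_hermHq_of_hasSum hT, ← Hq.eval_apply]
    rfl
  simp only [h2] at h1
  rw [← Hq.eval_apply]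
  exact h1.unique (hasSum_maOp ρ x f)

/-! ### The operators on polynomials -/

lemma gaussDeriv_add (p r : Polynomial ℝ) : gaussDeriv (p + r) = gaussDeriv p + gaussDeriv r := by
  simp only [gaussDeriv, map_add]; ring

lemma gaussDeriv_C_mul (c : ℝ) (p : Polynomial ℝ) :
    gaussDeriv (Polynomial.C c * p) = Polynomial.C c * gaussDeriv p := by
  simp only [gaussDeriv, Polynomial.derivative_C_mul]; ring

lemma iterate_gaussDeriv_add (n : ℕ) (p r : Polynomial ℝ) :
    gaussDeriv^[n] (p + r) = gaussDeriv^[n] p + gaussDeriv^[n] r := by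
  induction n generalizing p r with
  | zero => rfl
  | succ n ih => simp only [Function.iterate_succ_apply, gaussDeriv_add, ih]

lemma iterate_gaussDeriv_C_mul (n : ℕ) (c : ℝ) (p : Polynomial ℝ) :
    gaussDeriv^[n] (Polynomial.C c * p) = Polynomial.C c * gaussDeriv^[n] p := by
  induction n generalizing p with
  | zero => rfl
  | succ n ih => simp only [Function.iterate_succ_apply, gaussDeriv_C_mul, ih]

lemma iterate_gaussDeriv_hermR (n k : ℕ) :
    gaussDeriv^[n] (hermR k) = Polynomial.C ((-1) ^ n) * hermR (k + n) := by
  induction n with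
  | zero => simp
  | succ n ih =>
    rw [Function.iterate_succ_apply', ih, gaussDeriv_C_mul, ← add_assoc, hermR_succ_eq, ← mul_assoc,
      ← Polynomial.C_mul, pow_succ]
    simp

/-- Induction on polynomials along the Hermite polynomials. -/
lemma polynomial_hermR_induction {motive : Polynomial ℝ → Prop}
    (herm : ∀ k, motive (hermR k)) (add : ∀ p r, motive p → motive r → motive (p + r))
    (C_mul : ∀ c p, motive p → motive (Polynomial.C c * p)) (p : Polynomial ℝ) : motive p := by
  induction p using Polynomial.induction_on' with
  | add p r hp hr => exact add p r hp hr
  | monomial n c =>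
    obtain ⟨a, -, -, ha, -⟩ := exists_pow_eq_sum_hermiteHat (le_refl 1) n
    have h : Polynomial.monomial n c = Polynomial.C c * ∑ k ∈ Finset.range (n + 1),
        Polynomial.C (a k / Real.sqrt (k.factorial : ℝ)) * hermR k := by
      refine Polynomial.funext fun x => ?_
      rw [Polynomial.eval_monomial, ha, Polynomial.eval_mul, Polynomial.eval_C,
        Polynomial.eval_finsetSum]
      congr 1
      refine Finset.sum_congr rfl fun k _ => ?_
      rw [Polynomial.eval_mul, Polynomial.eval_C, hermiteHat_eq]
      ring
    rw [h]
    refine C_mul _ _ (Finset.sum_induction _ motive add ?_ fun k _ => C_mul _ _ (herm k))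
    simpa using C_mul 0 _ (herm 0)

/-- On polynomials the functional, defined by Hermite coefficients, is the integral of a derivative:
`(p φ)⁽ⁿ⁾` is `gaussDeriv^[n] p` times `φ`, and `gaussDeriv` raises the Hermite index up to sign. -/
lemma coeffFunctional_toHq (n : ℕ) (p : Polynomial ℝ) :
    coeffFunctional q n (toHq q p) = ((-1) ^ n * tailInt (gaussDeriv^[n] p) 0 : ℝ) := by
  induction p using polynomial_hermR_induction with
  | herm k =>
    rw [coeffFunctional_toHq_hermR, iterate_gaussDeriv_hermR, tailInt_C_mul, ← mul_assoc, ← mul_pow]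
    simp
  | add p r hp hr =>
    rw [toHq_add, map_add, hp, hr, iterate_gaussDeriv_add, tailInt_add]
    push_cast
    ring
  | C_mul c p hp =>
    rw [toHq_C_mul, map_smul, hp, iterate_gaussDeriv_C_mul, tailInt_C_mul, smul_eq_mul]
    push_cast
    ring

lemma iteratedDeriv_toHq_mul_phi (n : ℕ) (p : Polynomial ℝ) :
    iteratedDeriv n (fun t : ℝ => toHq q p t * (phi t : ℂ))
      = fun t => (((gaussDeriv^[n] p).eval t * phi t : ℝ) : ℂ) := by
  induction n with
  | zero => funext t; simp [toHq_apply]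
  | succ n ih =>
    rw [iteratedDeriv_succ, ih]
    funext t
    rw [Function.iterate_succ_apply']
    exact (hasDerivAt_eval_mul_phi _ t).ofReal_comp.deriv

/-- Agreement on polynomials suffices, as the recursion produces only polynomials. -/
lemma maOpCoeff_toHq (n : ℕ) (p : Polynomial ℝ) (x : ℝ) :
    maOpCoeff n (toHq q p) x = coeffOp q n (toHq q p) x := by
  rw [maOpCoeff, iteratedDeriv_toHq_mul_phi, integral_complex_ofReal, coeffOp_apply,
    coeffFunctional_toHq, tailInt]
  push_cast
  ring

/-- The coefficient of `xⁿ` in `T⁽ⁿ⁾ p`. -/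
def polyCoeff (n : ℕ) (p : Polynomial ℝ) : ℝ :=
  (-1) ^ n * tailInt (gaussDeriv^[n] p) 0 / n.factorial

lemma coeffOp_toHq (n : ℕ) (p : Polynomial ℝ) :
    coeffOp q n (toHq q p) = toHq q (Polynomial.C (polyCoeff n p) * Polynomial.X ^ n) := by
  refine DFunLike.ext _ _ fun x => ?_
  rw [coeffOp_apply, coeffFunctional_toHq, toHq_apply, polyCoeff]
  simp only [Polynomial.eval_mul, Polynomial.eval_C, Polynomial.eval_pow, Polynomial.eval_X]
  push_cast
  ring

lemma coeffFunctional_zero_toHq (p : Polynomial ℝ) :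
    coeffFunctional q 0 (toHq q p) = (tailInt p 0 : ℝ) := by
  simp [coeffFunctional_toHq]

lemma maOpCoeff_zero_toHq (p : Polynomial ℝ) (x : ℝ) :
    maOpCoeff 0 (toHq q p) x = (tailInt p 0 : ℝ) := by
  rw [maOpCoeff_toHq, coeffOp_apply, coeffFunctional_zero_toHq]
  simp

/-! ### The coefficients of the normalized expansion -/

/-- The coefficients of the expansion of the normalized leading eigenfunction. -/
def eigPoly : ℕ → Polynomial ℝ
  | 0 => 1
  -- Summation over `Fin` keeps the bound `j < m`, from which the call at `j + 1` is seen to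
  -- decrease.
  | m + 1 => Polynomial.C 2 *
      (∑ j : Fin (m + 1), Polynomial.C (polyCoeff (j + 1) (eigPoly (m - j))) *
          Polynomial.X ^ ((j : ℕ) + 1)
        - ∑ j : Fin m, Polynomial.C (tailInt (eigPoly (j + 1)) 0) * eigPoly (m - j))
termination_by n => n
decreasing_by all_goals omega

/-- The coefficients of the expansion of the leading eigenvalue. -/
def eigCoeff (n : ℕ) : ℝ := tailInt (eigPoly n) 0

lemma eigPoly_zero : eigPoly 0 = 1 := by rw [eigPoly]

lemma eigPoly_succ (m : ℕ) : eigPoly (m + 1) = Polynomial.C 2 *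
    (∑ j ∈ Finset.range (m + 1), Polynomial.C (polyCoeff (j + 1) (eigPoly (m - j))) *
        Polynomial.X ^ (j + 1)
      - ∑ j ∈ Finset.range m, Polynomial.C (eigCoeff (j + 1)) * eigPoly (m - j)) := by
  rw [eigPoly, Finset.sum_range, Finset.sum_range]
  rfl

lemma eigCoeff_zero : eigCoeff 0 = 1 / 2 := by rw [eigCoeff, eigPoly_zero, tailInt_one_zero]

lemma natDegree_eigPoly_le (m : ℕ) : (eigPoly m).natDegree ≤ m := by
  induction m using Nat.strong_induction_on with
  | _ m ih =>
    cases m with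
    | zero => simp [eigPoly_zero]
    | succ m =>
      rw [eigPoly_succ]
      refine (Polynomial.natDegree_C_mul_le _ _).trans 
        ((Polynomial.natDegree_sub_le_of_le (m := m + 1) (n := m + 1) ?_ ?_).trans_eq (max_self _))
      · refine Polynomial.natDegree_sum_le_of_forall_le _ _ fun j hj => ?_
        have := Finset.mem_range.1 hj
        exact (Polynomial.natDegree_C_mul_X_pow_le _ _).trans (by omega)
      · refine Polynomial.natDegree_sum_le_of_forall_le _ _ fun j hj => ?_
        exact (Polynomial.natDegree_C_mul_le _ _).trans ((ih (m - j) (by omega)).trans (by omega))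

lemma toHq_eigPoly_succ (m : ℕ) : toHq q (eigPoly (m + 1)) = (2 : ℂ) •
    (∑ j ∈ Finset.range (m + 1), coeffOp q (j + 1) (toHq q (eigPoly (m - j)))
      - ∑ j ∈ Finset.range m, (eigCoeff (j + 1) : ℂ) • toHq q (eigPoly (m - j))) := by
  rw [eigPoly_succ, toHq_C_mul, toHq_sub, toHq_sum, toHq_sum]
  simp only [coeffOp_toHq, toHq_C_mul]
  norm_num

lemma isSolution_eigPoly : (maPerturbation q).IsSolution fun m => toHq q (eigPoly m) := by
  refine ⟨congrArg (toHq q) eigPoly_zero, fun m => ?_⟩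
  beta_reduce
  rw [toHq_eigPoly_succ]
  simp only [maPerturbation, coeffFunctional_zero_toHq, eigCoeff]

/-! ### The leading eigenpair -/

/-- The abstract eigenvalue is real, its coefficients being integrals of real polynomials, and
positive, being within `1/8` of `1/2`; so it equals the spectral radius. The pointwise formula
determines the operator, hence any other leading eigenpair belongs to the same `T` and is a multiple
of this one. -/
lemma exists_leadingEigenpair (q : Set.Ioo (0 : ℝ) 1) :
    ∃ r > 0, ∀ ρ : ℝ, |ρ| < r → ∃ (lam : ℝ) (f : Hq q), IsLeadingEigenpair ρ lam f ∧ f 0 = 1 ∧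
      HasSum (fun n => ρ ^ n * eigCoeff n) lam ∧
      HasSum (fun m => (ρ : ℂ) ^ m • toHq q (eigPoly m)) f ∧
      (Summable fun m => ‖(ρ : ℂ) ^ m • toHq q (eigPoly m)‖) ∧
      ∀ (lam' : ℝ) (f' : Hq q), IsLeadingEigenpair ρ lam' f' → lam' = lam ∧ f' = f' 0 • f := by
  obtain ⟨r, hr, H⟩ := (maPerturbation q).exists_radius isSolution_eigPoly
  refine ⟨r, hr, fun ρ hρ => ?_⟩
  obtain ⟨T, f, hT, hsum, hf, hev, hTf, hhalf, hrad, huniq⟩ := H ρ hρ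
  have hTma : ∀ (h : Hq q) (x : ℝ), T h x = maOp ρ h x := apply_eq_maOp_of_hasSum hT
  set z := (maPerturbation q).ℓ f with hz
  have hsumz : HasSum (fun n => ((ρ ^ n * eigCoeff n : ℝ) : ℂ)) z := by
    have h := (maPerturbation q).ℓ.hasSum hf
    convert h using 2 with n
    rw [map_smul]
    change _ = _ • coeffFunctional q 0 _
    rw [coeffFunctional_zero_toHq, eigCoeff]
    push_cast
    rfl
  have hre : HasSum (fun n => ρ ^ n * eigCoeff n) z.re := by
    simpa only [Complex.ofReal_re] using Complex.hasSum_re hsumz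
  have hzre : z = (z.re : ℂ) := hsumz.unique (Complex.hasSum_ofReal.2 hre)
  have hpos : 0 < z.re := by
    have h1 := (Complex.abs_re_le_norm (z - 1 / 2)).trans hhalf
    have h2 : (z - 1 / 2).re = z.re - 1 / 2 := by simp
    rw [h2] at h1
    linarith [(abs_le.1 h1).1]
  have hrad' : z.re = (spectralRadius ℂ T).toReal := by
    rw [hrad, ENNReal.coe_toReal, coe_nnnorm, hzre, Complex.norm_real, Complex.ofReal_re,
      Real.norm_of_nonneg hpos.le]
  have hf0 : f 0 = 1 := by rw [← Hq.eval_apply]; exact hev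
  refine ⟨z.re, f, ⟨T, hTma, hrad', ?_, by rw [hTf, ← hzre]⟩, hf0, hre, hf, hsum, ?_⟩
  · rintro rfl
    exact one_ne_zero (hf0.symm.trans rfl)
  · rintro lam' f' ⟨T', hT', hlam', -, hTf'⟩
    have hTT : T' = T := ContinuousLinearMap.ext fun h => DFunLike.ext _ _ fun x => by
      rw [hT', hTma]
    subst hTT
    have hlam : lam' = z.re := hlam'.trans hrad'.symm
    refine ⟨hlam, ?_⟩
    rw [hlam, ← hzre] at hTf'
    have := huniq f' hTf'
    rwa [show (maPerturbation q).ev f' = f' 0 from Hq.eval_apply 0 f'] at this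

theorem isNormalizedExpansion_eigPoly :
    IsNormalizedExpansion eigCoeff fun m => toHq q (eigPoly m) := by
  obtain ⟨r, hr, H⟩ := exists_leadingEigenpair q
  refine ⟨r, hr, fun ρ hρ => ?_⟩
  obtain ⟨lam, f, h1, h2, h3, h4, -⟩ := H ρ hρ
  exact ⟨lam, f, h1, h2, h3, h4⟩

lemma IsNormalizedExpansion.isExpansion {K : ℕ → ℝ} {g : ℕ → Hq q}
    (h : IsNormalizedExpansion K g) : IsExpansion K g := by
  obtain ⟨r, hr, H⟩ := h
  refine ⟨r, hr, fun ρ hρ => ?_⟩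
  obtain ⟨lam, f, h1, -, h3, h4⟩ := H ρ hρ
  exact ⟨lam, f, h1, h3, h4⟩

theorem IsExpansion.eigCoeff_eq {K : ℕ → ℝ} {g : ℕ → Hq q} (h : IsExpansion K g) :
    K = eigCoeff := by
  obtain ⟨r, hr, H⟩ := h
  obtain ⟨r', hr', H'⟩ := exists_leadingEigenpair q
  refine eq_of_hasSum_pow_smul (lt_min hr hr') fun ρ hρ => ?_
  obtain ⟨lam, f, h1, h2, -⟩ := H ρ (hρ.trans_le (min_le_left _ _))
  obtain ⟨lam', f', -, -, h3, -, -, huniq⟩ := H' ρ (hρ.trans_le (min_le_right _ _))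
  obtain ⟨rfl, -⟩ := huniq lam f h1
  exact ⟨lam, h2, h3⟩

/-- The given eigenfunction is its value at `0` times the normalized one. That value has the
expansion `∑ ρᵐ g_m(0)`, so the Cauchy product and uniqueness of coefficients apply. -/
theorem IsExpansion.eq_sum {K : ℕ → ℝ} {g : ℕ → Hq q} (h : IsExpansion K g) (m : ℕ) :
    g m = ∑ p ∈ Finset.HasAntidiagonal.antidiagonal m, g p.1 0 • toHq q (eigPoly p.2) := by
  obtain ⟨r, hr, H⟩ := h
  obtain ⟨r', hr', H'⟩ := exists_leadingEigenpair q
  refine congrFun (eq_of_hasSum_pow_smul (h := fun m =>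
    ∑ p ∈ Finset.HasAntidiagonal.antidiagonal m, g p.1 0 • toHq q (eigPoly p.2))
    (lt_min hr hr') fun ρ hρ => ?_) m
  obtain ⟨lam, f, h1, -, h2⟩ := H ρ (hρ.trans_le (min_le_left _ _))
  obtain ⟨lam', f', -, -, -, h3, h4, huniq⟩ := H' ρ (hρ.trans_le (min_le_right _ _))
  obtain ⟨-, h5⟩ := huniq lam f h1
  have hev : HasSum (fun m => (ρ : ℂ) ^ m * g m 0) (f 0) := by
    have := (Hq.eval q 0).hasSum h2
    simpa only [map_smul, Hq.eval_apply, smul_eq_mul] using this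
  have hprod := hasSum_sum_antidiagonal_smul hev.summable.norm h4 hev h3
  rw [← h5] at hprod
  have hpow : ∀ (m : ℕ) (u : Hq q), (ρ ^ m : ℝ) • u = (ρ : ℂ) ^ m • u := fun m u => by
    rw [← Complex.coe_smul]
    push_cast
    rfl
  simp only [hpow]
  refine ⟨f, h2, ?_⟩
  convert hprod using 2 with n
  rw [Finset.smul_sum]
  refine Finset.sum_congr rfl fun p hp => ?_
  rw [smul_smul, smul_smul, mul_right_comm, ← pow_add, Finset.HasAntidiagonal.mem_antidiagonal.1 hp]

theorem IsNormalizedExpansion.eq_eigPoly {K : ℕ → ℝ} {g : ℕ → Hq q}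
    (h : IsNormalizedExpansion K g) : g = fun m => toHq q (eigPoly m) := by
  obtain ⟨r, hr, H⟩ := h
  obtain ⟨r', hr', H'⟩ := exists_leadingEigenpair q
  refine eq_of_hasSum_pow_smul (lt_min hr hr') fun ρ hρ => ?_
  obtain ⟨lam, f, h1, h0, -, h2⟩ := H ρ (hρ.trans_le (min_le_left _ _))
  obtain ⟨lam', f', -, -, -, h3, -, huniq⟩ := H' ρ (hρ.trans_le (min_le_right _ _))
  obtain ⟨-, h5⟩ := huniq lam f h1
  rw [h0, one_smul] at h5
  subst h5
  have hpow : ∀ (m : ℕ) (u : Hq q), (ρ ^ m : ℝ) • u = (ρ : ℂ) ^ m • u := fun m u => by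
    rw [← Complex.coe_smul]
    push_cast
    rfl
  simp only [hpow]
  exact ⟨f, h2, h3⟩

theorem IsExpansion.exists_polynomial {K : ℕ → ℝ} {g : ℕ → Hq q} (h : IsExpansion K g) (m : ℕ) :
    ∃ p : Polynomial ℂ, p.degree ≤ (m : WithBot ℕ) ∧ ∀ x : ℝ, g m x = p.eval (x : ℂ) := by
  refine ⟨∑ p ∈ Finset.HasAntidiagonal.antidiagonal m,
    Polynomial.C (g p.1 0) * (eigPoly p.2).map Complex.ofRealHom, ?_, fun x => ?_⟩
  · rw [← Polynomial.natDegree_le_iff_degree_le]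
    refine Polynomial.natDegree_sum_le_of_forall_le _ _ fun p hp => ?_
    have := Finset.HasAntidiagonal.mem_antidiagonal.1 hp
    refine (Polynomial.natDegree_C_mul_le _ _).trans (Polynomial.natDegree_map_le.trans ?_)
    exact (natDegree_eigPoly_le _).trans (by omega)
  · rw [h.eq_sum m, Hq.sum_apply, Polynomial.eval_finsetSum]
    refine Finset.sum_congr rfl fun p _ => ?_
    rw [Hq.smul_apply, toHq_apply, Polynomial.eval_mul, Polynomial.eval_C]
    congr 1
    exact (Polynomial.eval_map_apply Complex.ofRealHom x).symm

/-! ### The recursive characterization -/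

/-- The recursion for the coefficients of the normalized expansion. -/
def IsRecursive (K : ℕ → ℝ) (g : ℕ → Hq q) : Prop :=
  (∀ x : ℝ, g 0 x = 1) ∧ K 0 = 1 / 2 ∧ (∀ m : ℕ, 1 ≤ m → g m 0 = 0) ∧
    (∀ m : ℕ, 1 ≤ m → ∀ x : ℝ, g m x = 1 / (K 0 : ℂ) *
      (∑ j ∈ Finset.Icc 1 m, maOpCoeff j (g (m - j)) x
        - ∑ j ∈ Finset.Icc 1 (m - 1), maOpCoeff 0 (g j) x * g (m - j) x)) ∧
    (∀ n : ℕ, 1 ≤ n → ∀ x : ℝ, (K n : ℂ) = maOpCoeff 0 (g n) x)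

lemma sum_Icc_one_eq_sum_range {M : Type*} [AddCommMonoid M] (m : ℕ) (F : ℕ → M) :
    ∑ j ∈ Finset.Icc 1 m, F j = ∑ j ∈ Finset.range m, F (j + 1) := by
  rw [Finset.range_eq_Ico, Finset.sum_Ico_add' F 0 m 1]
  rfl

/-- Agreement of `g` with `eigPoly` is assumed only up to `m`, so that the identity serves both for
`eigPoly` itself and within the induction proving uniqueness. -/
lemma eigPoly_succ_apply (m : ℕ) {g : ℕ → Hq q} (hg : ∀ k ≤ m, g k = toHq q (eigPoly k)) (x : ℝ) :
    toHq q (eigPoly (m + 1)) x = 1 / ((1 / 2 : ℝ) : ℂ) *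
      (∑ j ∈ Finset.Icc 1 (m + 1), maOpCoeff j (g (m + 1 - j)) x
        - ∑ j ∈ Finset.Icc 1 (m + 1 - 1), maOpCoeff 0 (g j) x * g (m + 1 - j) x) := by
  rw [sum_Icc_one_eq_sum_range, sum_Icc_one_eq_sum_range, toHq_eigPoly_succ, Hq.smul_apply,
    sub_eq_add_neg, Hq.add_apply, ← neg_one_smul ℂ (Finset.sum _ _), Hq.smul_apply, Hq.sum_apply,
    Hq.sum_apply, Nat.add_sub_cancel]
  have h1 : ∀ j ∈ Finset.range (m + 1), maOpCoeff (j + 1) (g (m + 1 - (j + 1))) x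
      = coeffOp q (j + 1) (toHq q (eigPoly (m - j))) x := by
    intro j _
    rw [Nat.add_sub_add_right, hg _ (by omega), maOpCoeff_toHq]
  have h2 : ∀ j ∈ Finset.range m, maOpCoeff 0 (g (j + 1)) x * g (m + 1 - (j + 1)) x
      = ((eigCoeff (j + 1) : ℂ) • toHq q (eigPoly (m - j))) x := by
    intro j hj
    have := Finset.mem_range.1 hj
    rw [Nat.add_sub_add_right, hg _ (by omega), hg _ (by omega), maOpCoeff_zero_toHq, eigCoeff,
      Hq.smul_apply]
  rw [Finset.sum_congr rfl h1, Finset.sum_congr rfl h2]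
  push_cast
  ring

lemma isRecursive_eigPoly : IsRecursive (q := q) eigCoeff fun m => toHq q (eigPoly m) := by
  refine ⟨fun x => by simp [eigPoly_zero, toHq_apply], eigCoeff_zero, fun m hm => ?_,
    fun m hm x => ?_, fun n _ x => by rw [maOpCoeff_zero_toHq, eigCoeff]⟩
  · obtain ⟨k, rfl⟩ : ∃ k, m = k + 1 := ⟨m - 1, by omega⟩
    rw [← Hq.eval_apply]
    exact isSolution_eigPoly.ev_eq k
  · obtain ⟨k, rfl⟩ : ∃ k, m = k + 1 := ⟨m - 1, by omega⟩
    rw [eigCoeff_zero]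
    exact eigPoly_succ_apply k (g := fun m => toHq q (eigPoly m)) (fun _ _ => rfl) x

lemma IsRecursive.eq {K : ℕ → ℝ} {g : ℕ → Hq q} (h : IsRecursive K g) :
    K = eigCoeff ∧ g = fun m => toHq q (eigPoly m) := by
  obtain ⟨h0, hK0, -, hrec, hK⟩ := h
  have hg : ∀ m, g m = toHq q (eigPoly m) := by
    intro m
    induction m using Nat.strong_induction_on with
    | _ m ih =>
      cases m with
      | zero => exact DFunLike.ext _ _ fun x => by simp [h0, eigPoly_zero, toHq_apply]
      | succ m =>
        refine DFunLike.ext _ _ fun x => ?_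
        rw [eigPoly_succ_apply m (fun k hk => ih k (by omega)), hrec (m + 1) (by omega), hK0]
  refine ⟨funext fun n => ?_, funext hg⟩
  cases n with
  | zero => rw [hK0, eigCoeff_zero]
  | succ n =>
    have := hK (n + 1) (by omega) 0
    rw [hg, maOpCoeff_zero_toHq] at this
    exact_mod_cast this

/-- Each side singles out the same pair of sequences, `eigCoeff` and `eigPoly`. -/
theorem isNormalizedExpansion_iff (K : ℕ → ℝ) (g : ℕ → Hq q) :
    IsNormalizedExpansion K g ↔ IsRecursive K g := by
  constructor
  · intro h
    rw [h.isExpansion.eigCoeff_eq, h.eq_eigPoly]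
    exact isRecursive_eigPoly
  · intro h
    rw [h.eq.1, h.eq.2]
    exact isNormalizedExpansion_eigPoly

/-! ### Half-line moments and iterated derivatives in terms of coefficients -/

lemma tailInt_sub (p r : Polynomial ℝ) (t : ℝ) :
    tailInt (p - r) t = tailInt p t - tailInt r t := by
  rw [eq_sub_iff_add_eq, ← tailInt_add, sub_add_cancel]

lemma tailInt_sum {ι : Type*} (s : Finset ι) (p : ι → Polynomial ℝ) (t : ℝ) :
    tailInt (∑ i ∈ s, p i) t = ∑ i ∈ s, tailInt (p i) t := by
  classical
  induction s using Finset.induction_on with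
  | empty => simp [tailInt]
  | insert i s hi ih => rw [Finset.sum_insert hi, Finset.sum_insert hi, tailInt_add, ih]

lemma tailInt_X_zero : tailInt Polynomial.X 0 = phi 0 := by
  have h := tailInt_gaussDeriv 1 0
  have h1 : gaussDeriv 1 = Polynomial.C (-1) * Polynomial.X := by simp [gaussDeriv]
  rw [h1, tailInt_C_mul, Polynomial.eval_one] at h
  linarith

lemma tailInt_X_pow_zero (i : ℕ) :
    tailInt (Polynomial.X ^ (i + 2)) 0 = (i + 1) * tailInt (Polynomial.X ^ i) 0 := by
  have h := tailInt_gaussDeriv (Polynomial.X ^ (i + 1)) 0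
  have h1 : gaussDeriv (Polynomial.X ^ (i + 1))
      = Polynomial.C ((i : ℝ) + 1) * Polynomial.X ^ i - Polynomial.X ^ (i + 2) := by
    rw [gaussDeriv, Polynomial.derivative_X_pow]
    simp only [Nat.add_sub_cancel, Nat.cast_add, Nat.cast_one]
    ring
  rw [h1, tailInt_sub, tailInt_C_mul] at h
  simp only [Polynomial.eval_pow, Polynomial.eval_X] at h
  rw [zero_pow (by omega), zero_mul, neg_zero] at h
  linarith

/-- The value at `0` of the `n`-th iterate of `gaussDeriv` at `xⁱ`. -/
def gaussDerivValue : ℕ → ℕ → ℤ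
  | 0, 0 => 1
  | 0, _ + 1 => 0
  | n + 1, i + 1 => (n + 1) * gaussDerivValue n i
  | 1, 0 => 0
  | n + 2, 0 => -(n + 1) * gaussDerivValue n 0

/-- Leibniz' rule for `x · p φ`: the commutator of `gaussDeriv` with multiplication by `X` is the
identity. At `0` only the last term survives, which gives the recurrence of `gaussDerivValue`. -/
lemma iterate_gaussDeriv_X_mul (n : ℕ) (p : Polynomial ℝ) :
    gaussDeriv^[n + 1] (Polynomial.X * p) = Polynomial.X * gaussDeriv^[n + 1] p
      + Polynomial.C ((n : ℝ) + 1) * gaussDeriv^[n] p := by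
  have h : ∀ p, gaussDeriv (Polynomial.X * p) = Polynomial.X * gaussDeriv p + p := by
    intro p
    simp only [gaussDeriv, Polynomial.derivative_mul, Polynomial.derivative_X]
    ring
  induction n with
  | zero => simp [h]
  | succ n ih =>
    rw [Function.iterate_succ_apply', ih, gaussDeriv_add, h, gaussDeriv_C_mul,
      ← Function.iterate_succ_apply' gaussDeriv (n + 1), ← Function.iterate_succ_apply' gaussDeriv n]
    simp only [map_add, map_one, Nat.cast_add, Nat.cast_one]
    ring

lemma eval_iterate_gaussDeriv_X_pow : ∀ n i : ℕ,
    (gaussDeriv^[n] (Polynomial.X ^ i)).eval 0 = gaussDerivValue n i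
  | 0, 0 => by simp [gaussDerivValue]
  | 0, i + 1 => by simp [gaussDerivValue]
  | n + 1, i + 1 => by
    rw [pow_succ', iterate_gaussDeriv_X_mul, Polynomial.eval_add, Polynomial.eval_mul,
      Polynomial.eval_mul, eval_iterate_gaussDeriv_X_pow n i, gaussDerivValue]
    simp
  | 1, 0 => by simp [gaussDerivValue, gaussDeriv]
  | n + 2, 0 => by
    have h1 : gaussDeriv (Polynomial.X ^ 0) = Polynomial.C (-1) * (Polynomial.X * 1) := by
      simp [gaussDeriv]
    rw [Function.iterate_succ_apply, h1, iterate_gaussDeriv_C_mul, iterate_gaussDeriv_X_mul,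
      ← pow_zero Polynomial.X, Polynomial.eval_mul, Polynomial.eval_add, Polynomial.eval_mul,
      Polynomial.eval_mul, eval_iterate_gaussDeriv_X_pow n 0, gaussDerivValue]
    push_cast
    simp
    ring

lemma gaussDerivValue_of_lt : ∀ {n i : ℕ}, n < i → gaussDerivValue n i = 0
  | 0, i + 1, _ => by simp [gaussDerivValue]
  | n + 1, i + 1, h => by
    rw [gaussDerivValue, gaussDerivValue_of_lt (Nat.lt_of_succ_lt_succ h), mul_zero]

lemma eval_iterate_gaussDeriv (n : ℕ) (p : Polynomial ℝ) :
    (gaussDeriv^[n] p).eval 0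
      = ∑ l ∈ Finset.range (n + 1), (gaussDerivValue n l : ℝ) * p.coeff l := by
  induction p using Polynomial.induction_on' with
  | add p r hp hr =>
    simp only [iterate_gaussDeriv_add, Polynomial.eval_add, hp, hr, Polynomial.coeff_add, mul_add,
      Finset.sum_add_distrib]
  | monomial k c =>
    rw [← Polynomial.C_mul_X_pow_eq_monomial, iterate_gaussDeriv_C_mul, Polynomial.eval_mul,
      Polynomial.eval_C, eval_iterate_gaussDeriv_X_pow]
    simp only [Polynomial.coeff_C_mul, Polynomial.coeff_X_pow, mul_ite, mul_one, mul_zero,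
      Finset.sum_ite_eq', Finset.mem_range]
    split_ifs with h
    · ring
    · rw [gaussDerivValue_of_lt (by omega)]; simp

/-- The integral of `(p φ)⁽ⁿ⁺¹⁾` over the half-line is `-(p φ)⁽ⁿ⁾(0)`, hence `φ(0)` times an integer
combination of the coefficients of `p`. -/
lemma polyCoeff_succ (n : ℕ) (p : Polynomial ℝ) :
    polyCoeff (n + 1) p = phi 0 * ((-1) ^ n / (n + 1).factorial *
      ∑ l ∈ Finset.range (n + 1), (gaussDerivValue n l : ℝ) * p.coeff l) := by
  rw [polyCoeff, Function.iterate_succ_apply', tailInt_gaussDeriv, eval_iterate_gaussDeriv, pow_succ]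
  ring

lemma coeff_eigPoly_succ (m i : ℕ) (hi : i ≤ m) :
    (eigPoly (m + 1)).coeff (i + 1) = 2 * (polyCoeff (i + 1) (eigPoly (m - i))
      - ∑ j ∈ Finset.range m, eigCoeff (j + 1) * (eigPoly (m - j)).coeff (i + 1)) := by
  rw [eigPoly_succ, Polynomial.coeff_C_mul, Polynomial.coeff_sub, Polynomial.finsetSum_coeff,
    Polynomial.finsetSum_coeff]
  simp only [Polynomial.coeff_C_mul, Polynomial.coeff_X_pow, mul_ite, mul_one, mul_zero,
    Nat.add_right_cancel_iff]
  rw [Finset.sum_ite_eq, if_pos (Finset.mem_range.2 (by omega))]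

/-- Integrating the recursion yields the next eigenvalue coefficient from earlier polynomials only,
without the coefficients of `eigPoly (m + 1)`. -/
lemma eigCoeff_succ (m : ℕ) :
    eigCoeff (m + 1) = 2 * (∑ j ∈ Finset.range (m + 1),
        polyCoeff (j + 1) (eigPoly (m - j)) * tailInt (Polynomial.X ^ (j + 1)) 0
      - ∑ j ∈ Finset.range m, eigCoeff (j + 1) * eigCoeff (m - j)) := by
  rw [eigCoeff, eigPoly_succ, tailInt_C_mul, tailInt_sub, tailInt_sum, tailInt_sum]
  simp only [tailInt_C_mul]
  rfl

lemma coeff_zero_eigPoly_succ (m : ℕ) : (eigPoly (m + 1)).coeff 0 = 0 := by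
  -- Any `q` would do, since `eigPoly` does not depend on it.
  have h := (isSolution_eigPoly (q := ⟨1 / 2, by norm_num⟩)).ev_eq m
  change Hq.eval _ 0 _ = 0 at h
  rw [Hq.eval_apply, toHq_apply] at h
  rw [Polynomial.coeff_zero_eq_eval_zero]
  exact_mod_cast h

lemma coeff_eigPoly_of_lt {m l : ℕ} (h : m < l) : (eigPoly m).coeff l = 0 :=
  Polynomial.coeff_eq_zero_of_natDegree_lt ((natDegree_eigPoly_le m).trans_lt h)

/-! ### The first coefficients -/

lemma phi_zero_sq : phi 0 ^ 2 = 1 / (2 * Real.pi) := by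
  rw [phi_eq, mul_pow, inv_pow, Real.sq_sqrt (by positivity)]
  simp

/-- The recursion run by hand, with `κ` opaque for `ring`. The facts `p` are the monomial
coefficients of `T⁽ⁿ⁾ p`, `m` the half-line moments, `z` coefficients of `eigPoly` vanishing by
degree or normalization, and `c` the other coefficients that are needed. -/
lemma eigCoeff_eq_phi_zero_pow (κ : ℝ) (hκ : phi 0 = κ) :
    eigCoeff 1 = 2 * κ ^ 2 ∧
    eigCoeff 2 = (-8) * κ ^ 4 ∧
    eigCoeff 3 = (-5 / 3) * κ ^ 2 + 64 * κ ^ 6 ∧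
    eigCoeff 4 = (52 / 3) * κ ^ 4 + (-640) * κ ^ 8 ∧
    eigCoeff 5 = (23 / 20) * κ ^ 2 + (-224) * κ ^ 6 + 7168 * κ ^ 10 ∧
    eigCoeff 6 = (-1069 / 45) * κ ^ 4 + (9280 / 3) * κ ^ 8 + (-86016) * κ ^ 12 ∧
    eigCoeff 7 =
      (-37 / 56) * κ ^ 2 + (6736 / 15) * κ ^ 6 + (-132608 / 3) * κ ^ 10 + 1081344 * κ ^ 14 ∧
    eigCoeff 8 =
      (943 / 42) * κ ^ 4 + (-24560 / 3) * κ ^ 8 + 645120 * κ ^ 12 + (-14057472) * κ ^ 16 := by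
  have p1 : ∀ p, polyCoeff 1 p = κ * (1 * p.coeff 0) / 1 := fun p => by
    rw [polyCoeff_succ 0 p]
    simp only [hκ, Finset.sum_range_succ, Finset.sum_range_zero, gaussDerivValue, Nat.factorial]
    push_cast
    ring
  have p2 : ∀ p, polyCoeff 2 p = κ * (1 * p.coeff 1) / (-2) := fun p => by
    rw [polyCoeff_succ 1 p]
    simp only [hκ, Finset.sum_range_succ, Finset.sum_range_zero, gaussDerivValue, Nat.factorial]
    push_cast
    ring
  have p3 : ∀ p, polyCoeff 3 p = κ * ((-1) * p.coeff 0 + 2 * p.coeff 2) / 6 := fun p => by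
    rw [polyCoeff_succ 2 p]
    simp only [hκ, Finset.sum_range_succ, Finset.sum_range_zero, gaussDerivValue, Nat.factorial]
    push_cast
    ring
  have p4 : ∀ p, polyCoeff 4 p = κ * ((-3) * p.coeff 1 + 6 * p.coeff 3) / (-24) := fun p => by
    rw [polyCoeff_succ 3 p]
    simp only [hκ, Finset.sum_range_succ, Finset.sum_range_zero, gaussDerivValue, Nat.factorial]
    push_cast
    ring
  have p5 : ∀ p, polyCoeff 5 p =
      κ * (3 * p.coeff 0 + (-12) * p.coeff 2 + 24 * p.coeff 4) / 120 := fun p => by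
    rw [polyCoeff_succ 4 p]
    simp only [hκ, Finset.sum_range_succ, Finset.sum_range_zero, gaussDerivValue, Nat.factorial]
    push_cast
    ring
  have p6 : ∀ p, polyCoeff 6 p =
      κ * (15 * p.coeff 1 + (-60) * p.coeff 3 + 120 * p.coeff 5) / (-720) := fun p => by
    rw [polyCoeff_succ 5 p]
    simp only [hκ, Finset.sum_range_succ, Finset.sum_range_zero, gaussDerivValue, Nat.factorial]
    push_cast
    ring
  have p7 : ∀ p, polyCoeff 7 p =
      κ * ((-15) * p.coeff 0 + 90 * p.coeff 2 + (-360) * p.coeff 4 + 720 * p.coeff 6) / 5040 := fun p => by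
    rw [polyCoeff_succ 6 p]
    simp only [hκ, Finset.sum_range_succ, Finset.sum_range_zero, gaussDerivValue, Nat.factorial]
    push_cast
    ring
  have p8 : ∀ p, polyCoeff 8 p =
      κ * ((-105) * p.coeff 1 + 630 * p.coeff 3 + (-2520) * p.coeff 5 + 5040 * p.coeff 7) / (-40320) := fun p => by
    rw [polyCoeff_succ 7 p]
    simp only [hκ, Finset.sum_range_succ, Finset.sum_range_zero, gaussDerivValue, Nat.factorial]
    push_cast
    ring
  have m1 : tailInt (Polynomial.X ^ 1) 0 = κ := by rw [pow_one, tailInt_X_zero, hκ]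
  have m2 : tailInt (Polynomial.X ^ 2) 0 = 1 / 2 := by
    rw [tailInt_X_pow_zero 0, pow_zero, tailInt_one_zero]; norm_num
  have m3 : tailInt (Polynomial.X ^ 3) 0 = 2 * κ := by
    rw [tailInt_X_pow_zero 1, m1]; norm_num
  have m4 : tailInt (Polynomial.X ^ 4) 0 = 3 / 2 := by
    rw [tailInt_X_pow_zero 2, m2]; norm_num
  have m5 : tailInt (Polynomial.X ^ 5) 0 = 8 * κ := by
    rw [tailInt_X_pow_zero 3, m3]; norm_num; ring
  have m6 : tailInt (Polynomial.X ^ 6) 0 = 15 / 2 := by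
    rw [tailInt_X_pow_zero 4, m4]; norm_num
  have m7 : tailInt (Polynomial.X ^ 7) 0 = 48 * κ := by
    rw [tailInt_X_pow_zero 5, m5]; norm_num; ring
  have m8 : tailInt (Polynomial.X ^ 8) 0 = 105 / 2 := by
    rw [tailInt_X_pow_zero 6, m6]; norm_num
  have z00 : (eigPoly 0).coeff 0 = 1 := by rw [eigPoly_zero]; simp
  have z10 : (eigPoly 1).coeff 0 = 0 := coeff_zero_eigPoly_succ 0
  have z20 : (eigPoly 2).coeff 0 = 0 := coeff_zero_eigPoly_succ 1
  have z30 : (eigPoly 3).coeff 0 = 0 := coeff_zero_eigPoly_succ 2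
  have z40 : (eigPoly 4).coeff 0 = 0 := coeff_zero_eigPoly_succ 3
  have z50 : (eigPoly 5).coeff 0 = 0 := coeff_zero_eigPoly_succ 4
  have z60 : (eigPoly 6).coeff 0 = 0 := coeff_zero_eigPoly_succ 5
  have z70 : (eigPoly 7).coeff 0 = 0 := coeff_zero_eigPoly_succ 6
  have z01 : (eigPoly 0).coeff 1 = 0 := coeff_eigPoly_of_lt (by norm_num)
  have z02 : (eigPoly 0).coeff 2 = 0 := coeff_eigPoly_of_lt (by norm_num)
  have z03 : (eigPoly 0).coeff 3 = 0 := coeff_eigPoly_of_lt (by norm_num)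
  have z04 : (eigPoly 0).coeff 4 = 0 := coeff_eigPoly_of_lt (by norm_num)
  have z05 : (eigPoly 0).coeff 5 = 0 := coeff_eigPoly_of_lt (by norm_num)
  have z06 : (eigPoly 0).coeff 6 = 0 := coeff_eigPoly_of_lt (by norm_num)
  have z07 : (eigPoly 0).coeff 7 = 0 := coeff_eigPoly_of_lt (by norm_num)
  have z12 : (eigPoly 1).coeff 2 = 0 := coeff_eigPoly_of_lt (by norm_num)
  have z13 : (eigPoly 1).coeff 3 = 0 := coeff_eigPoly_of_lt (by norm_num)
  have z14 : (eigPoly 1).coeff 4 = 0 := coeff_eigPoly_of_lt (by norm_num)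
  have z15 : (eigPoly 1).coeff 5 = 0 := coeff_eigPoly_of_lt (by norm_num)
  have z16 : (eigPoly 1).coeff 6 = 0 := coeff_eigPoly_of_lt (by norm_num)
  have z23 : (eigPoly 2).coeff 3 = 0 := coeff_eigPoly_of_lt (by norm_num)
  have z24 : (eigPoly 2).coeff 4 = 0 := coeff_eigPoly_of_lt (by norm_num)
  have z25 : (eigPoly 2).coeff 5 = 0 := coeff_eigPoly_of_lt (by norm_num)
  have z34 : (eigPoly 3).coeff 4 = 0 := coeff_eigPoly_of_lt (by norm_num)
  have c11 : (eigPoly 1).coeff 1 = 2 * κ ^ 1 := by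
    rw [coeff_eigPoly_succ 0 0 (by norm_num)]
    simp only [Finset.sum_range_zero, Nat.reduceAdd, Nat.sub_zero,
      p1, z00]
    ring
  have K1 : eigCoeff 1 = 2 * κ ^ 2 := by
    rw [eigCoeff_succ 0]
    simp only [Finset.sum_range_succ, Finset.sum_range_zero, Nat.reduceAdd, Nat.sub_zero,
      p1, m1, z00]
    ring
  have c21 : (eigPoly 2).coeff 1 = (-8) * κ ^ 3 := by
    rw [coeff_eigPoly_succ 1 0 (by norm_num)]
    simp only [Finset.sum_range_succ, Finset.sum_range_zero, Nat.reduceAdd, Nat.sub_zero,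
      p1, z10, c11, K1]
    ring
  have c22 : (eigPoly 2).coeff 2 = 0 := by
    rw [coeff_eigPoly_succ 1 1 (by norm_num)]
    simp only [Finset.sum_range_succ, Finset.sum_range_zero, Nat.reduceAdd, Nat.reduceSub,
      Nat.sub_zero,
      p2, z01, z12, K1]
    ring
  have K2 : eigCoeff 2 = (-8) * κ ^ 4 := by
    rw [eigCoeff_succ 1]
    simp only [Finset.sum_range_succ, Finset.sum_range_zero, Nat.reduceAdd, Nat.reduceSub,
      Nat.sub_zero,
      p1, p2, m1, m2, z10, z01, K1]
    ring
  have c31 : (eigPoly 3).coeff 1 = 64 * κ ^ 5 := by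
    rw [coeff_eigPoly_succ 2 0 (by norm_num)]
    simp only [Finset.sum_range_succ, Finset.sum_range_zero, Nat.reduceAdd, Nat.reduceSub,
      Nat.sub_zero,
      p1, z20, c11, c21, K1, K2]
    ring
  have c32 : (eigPoly 3).coeff 2 = (-2) * κ ^ 2 := by
    rw [coeff_eigPoly_succ 2 1 (by norm_num)]
    simp only [Finset.sum_range_succ, Finset.sum_range_zero, Nat.reduceAdd, Nat.reduceSub,
      Nat.sub_zero,
      p2, z12, c11, c22, K1, K2]
    ring
  have c33 : (eigPoly 3).coeff 3 = (-1 / 3) * κ ^ 1 := by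
    rw [coeff_eigPoly_succ 2 2 (by norm_num)]
    simp only [Finset.sum_range_succ, Finset.sum_range_zero, Nat.reduceAdd, Nat.reduceSub,
      Nat.sub_zero,
      p3, z00, z02, z13, z23, K1, K2]
    ring
  have K3 : eigCoeff 3 = (-5 / 3) * κ ^ 2 + 64 * κ ^ 6 := by
    rw [eigCoeff_succ 2]
    simp only [Finset.sum_range_succ, Finset.sum_range_zero, Nat.reduceAdd, Nat.reduceSub,
      Nat.sub_zero,
      p1, p2, p3, m1, m2, m3, z00, z20, z02, c11, K1, K2]
    ring
  have c41 : (eigPoly 4).coeff 1 = (20 / 3) * κ ^ 3 + (-640) * κ ^ 7 := by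
    rw [coeff_eigPoly_succ 3 0 (by norm_num)]
    simp only [Finset.sum_range_succ, Finset.sum_range_zero, Nat.reduceAdd, Nat.reduceSub,
      Nat.sub_zero,
      p1, z30, c11, c21, c31, K1, K2, K3]
    ring
  have c42 : (eigPoly 4).coeff 2 = 16 * κ ^ 4 := by
    rw [coeff_eigPoly_succ 3 1 (by norm_num)]
    simp only [Finset.sum_range_succ, Finset.sum_range_zero, Nat.reduceAdd, Nat.reduceSub,
      Nat.sub_zero,
      p2, z12, c21, c22, c32, K1, K2, K3]
    ring
  have c43 : (eigPoly 4).coeff 3 = (4 / 3) * κ ^ 3 := by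
    rw [coeff_eigPoly_succ 3 2 (by norm_num)]
    simp only [Finset.sum_range_succ, Finset.sum_range_zero, Nat.reduceAdd, Nat.reduceSub,
      Nat.sub_zero,
      p3, z10, z12, z13, z23, c33, K1, K2, K3]
    ring
  have K4 : eigCoeff 4 = (52 / 3) * κ ^ 4 + (-640) * κ ^ 8 := by
    rw [eigCoeff_succ 3]
    simp only [Finset.sum_range_succ, Finset.sum_range_zero, Nat.reduceAdd, Nat.reduceSub,
      Nat.sub_zero,
      p1, p2, p3, p4, m1, m2, m3, m4, z10, z30, z01, z03, z12, c21, K1, K2, K3]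
    ring
  have c51 : (eigPoly 5).coeff 1 = (-368 / 3) * κ ^ 5 + 7168 * κ ^ 9 := by
    rw [coeff_eigPoly_succ 4 0 (by norm_num)]
    simp only [Finset.sum_range_succ, Finset.sum_range_zero, Nat.reduceAdd, Nat.reduceSub,
      Nat.sub_zero,
      p1, z40, c11, c21, c31, c41, K1, K2, K3, K4]
    ring
  have c52 : (eigPoly 5).coeff 2 = (-160) * κ ^ 6 := by
    rw [coeff_eigPoly_succ 4 1 (by norm_num)]
    simp only [Finset.sum_range_succ, Finset.sum_range_zero, Nat.reduceAdd, Nat.reduceSub,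
      Nat.sub_zero,
      p2, z12, c22, c31, c32, c42, K1, K2, K3, K4]
    ring
  have K5 : eigCoeff 5 = (23 / 20) * κ ^ 2 + (-224) * κ ^ 6 + 7168 * κ ^ 10 := by
    rw [eigCoeff_succ 4]
    simp only [Finset.sum_range_succ, Finset.sum_range_zero, Nat.reduceAdd, Nat.reduceSub,
      Nat.sub_zero,
      p1, p2, p3, p4, p5, m1, m2, m3, m4, m5, z00, z20, z40, z02, z04, z13, c11, c22, c31, K1, K2,
      K3, K4]
    ring
  have c61 : (eigPoly 6).coeff 1 = (-23 / 5) * κ ^ 3 + 1984 * κ ^ 7 + (-86016) * κ ^ 11 := by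
    rw [coeff_eigPoly_succ 5 0 (by norm_num)]
    simp only [Finset.sum_range_succ, Finset.sum_range_zero, Nat.reduceAdd, Nat.reduceSub,
      Nat.sub_zero,
      p1, z50, c11, c21, c31, c41, c51, K1, K2, K3, K4, K5]
    ring
  have K6 : eigCoeff 6 = (-1069 / 45) * κ ^ 4 + (9280 / 3) * κ ^ 8 + (-86016) * κ ^ 12 := by
    rw [eigCoeff_succ 5]
    simp only [Finset.sum_range_succ, Finset.sum_range_zero, Nat.reduceAdd, Nat.reduceSub,
      Nat.sub_zero,
      p1, p2, p3, p4, p5, p6, m1, m2, m3, m4, m5, m6, z10, z30, z50, z01, z03, z05, z12, z14, z23,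
      c21, c32, c41, K1, K2, K3, K4, K5]
    ring
  have K7 : eigCoeff 7 =
      (-37 / 56) * κ ^ 2 + (6736 / 15) * κ ^ 6 + (-132608 / 3) * κ ^ 10 + 1081344 * κ ^ 14 := by
    rw [eigCoeff_succ 6]
    simp only [Finset.sum_range_succ, Finset.sum_range_zero, Nat.reduceAdd, Nat.reduceSub,
      Nat.sub_zero,
      p1, p2, p3, p4, p5, p6, p7, m1, m2, m3, m4, m5, m6, m7, z00, z20, z40, z60, z02, z04, z06,
      z13, z15, z24, c11, c22, c31, c33, c42, c51, K1, K2, K3, K4, K5, K6]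
    ring
  have K8 : eigCoeff 8 =
      (943 / 42) * κ ^ 4 + (-24560 / 3) * κ ^ 8 + 645120 * κ ^ 12 + (-14057472) * κ ^ 16 := by
    rw [eigCoeff_succ 7]
    simp only [Finset.sum_range_succ, Finset.sum_range_zero, Nat.reduceAdd, Nat.reduceSub,
      Nat.sub_zero,
      p1, p2, p3, p4, p5, p6, p7, p8, m1, m2, m3, m4, m5, m6, m7, m8,
      z10, z30, z50, z70, z01, z03, z05, z07, z12, z14, z16, z23, z25, z34,
      c21, c32, c41, c43, c52, c61, K1, K2, K3, K4, K5, K6, K7]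
    ring
  exact ⟨K1, K2, K3, K4, K5, K6, K7, K8⟩

/-- The first coefficients of the leading eigenvalue. -/
theorem eigCoeff_values :
    eigCoeff 0 = 1 / 2 ∧
    eigCoeff 1 = 1 / Real.pi ∧
    eigCoeff 2 = -(2 / Real.pi ^ 2) ∧
    eigCoeff 3 = -(5 / (6 * Real.pi)) + 8 / Real.pi ^ 3 ∧
    eigCoeff 4 = 13 / (3 * Real.pi ^ 2) - 40 / Real.pi ^ 4 ∧
    eigCoeff 5 = 23 / (40 * Real.pi) - 28 / Real.pi ^ 3 + 224 / Real.pi ^ 5 ∧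
    eigCoeff 6 = -(1069 / (180 * Real.pi ^ 2)) + 580 / (3 * Real.pi ^ 4) - 1344 / Real.pi ^ 6 ∧
    eigCoeff 7 = -(37 / (112 * Real.pi)) + 842 / (15 * Real.pi ^ 3) - 4144 / (3 * Real.pi ^ 5)
      + 8448 / Real.pi ^ 7 ∧
    eigCoeff 8 = 943 / (168 * Real.pi ^ 2) - 1535 / (3 * Real.pi ^ 4) + 10080 / Real.pi ^ 6
      - 54912 / Real.pi ^ 8 := by
  have hπ : Real.pi ≠ 0 := Real.pi_ne_zero
  have hpow : ∀ j, phi 0 ^ (2 * j) = (1 / (2 * Real.pi)) ^ j := fun j => by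
    rw [pow_mul, phi_zero_sq]
  have h1 := hpow 1
  have h2 := hpow 2
  have h3 := hpow 3
  have h4 := hpow 4
  have h5 := hpow 5
  have h6 := hpow 6
  have h7 := hpow 7
  have h8 := hpow 8
  -- Turns the exponents `2 * j` into numerals, as they appear in the formulas to be rewritten.
  norm_num only at h1 h2 h3 h4 h5 h6 h7 h8
  obtain ⟨k1, k2, k3, k4, k5, k6, k7, k8⟩ := eigCoeff_eq_phi_zero_pow (phi 0) rfl
  rw [k1, k2, k3, k4, k5, k6, k7, k8, eigCoeff_zero, h1, h2, h3, h4, h5, h6, h7, h8]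
  refine ⟨rfl, ?_, ?_, ?_, ?_, ?_, ?_, ?_, ?_⟩ <;> field_simp <;> ring

end

end MAPersistence

/-! ### The theorem, assembled -/

theorem theorem3 (q : Set.Ioo (0 : ℝ) 1) :
    -- such power series exist
    (∃ (K : ℕ → ℝ) (g : ℕ → MAPersistence.Hq q), MAPersistence.IsNormalizedExpansion K g) ∧
    -- `g_m` is a polynomial of degree at most `m`, however the eigenfunctions are normalized
    (∀ (K : ℕ → ℝ) (g : ℕ → MAPersistence.Hq q), MAPersistence.IsExpansion K g →
      ∀ m : ℕ, ∃ p : Polynomial ℂ, p.degree ≤ (m : WithBot ℕ) ∧ ∀ x : ℝ, g m x = p.eval (x : ℂ)) ∧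
    -- the full iterative description of the `g_m` and `K_n`
    (∀ (K : ℕ → ℝ) (g : ℕ → MAPersistence.Hq q), MAPersistence.IsNormalizedExpansion K g ↔
      ((∀ x : ℝ, g 0 x = 1) ∧ K 0 = 1 / 2 ∧ (∀ m : ℕ, 1 ≤ m → g m 0 = 0) ∧
        (∀ m : ℕ, 1 ≤ m → ∀ x : ℝ, g m x = 1 / (K 0 : ℂ) *
          (∑ j ∈ Finset.Icc 1 m, MAPersistence.maOpCoeff j (g (m - j)) x
            - ∑ j ∈ Finset.Icc 1 (m - 1), MAPersistence.maOpCoeff 0 (g j) x * g (m - j) x)) ∧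
        (∀ n : ℕ, 1 ≤ n → ∀ x : ℝ, (K n : ℂ) = MAPersistence.maOpCoeff 0 (g n) x))) ∧
    -- the first coefficients
    (∀ (K : ℕ → ℝ) (g : ℕ → MAPersistence.Hq q), MAPersistence.IsExpansion K g →
      K 0 = 1 / 2 ∧
      K 1 = 1 / Real.pi ∧
      K 2 = -(2 / Real.pi ^ 2) ∧
      K 3 = -(5 / (6 * Real.pi)) + 8 / Real.pi ^ 3 ∧
      K 4 = 13 / (3 * Real.pi ^ 2) - 40 / Real.pi ^ 4 ∧
      K 5 = 23 / (40 * Real.pi) - 28 / Real.pi ^ 3 + 224 / Real.pi ^ 5 ∧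
      K 6 = -(1069 / (180 * Real.pi ^ 2)) + 580 / (3 * Real.pi ^ 4) - 1344 / Real.pi ^ 6 ∧
      K 7 = -(37 / (112 * Real.pi)) + 842 / (15 * Real.pi ^ 3) - 4144 / (3 * Real.pi ^ 5)
        + 8448 / Real.pi ^ 7 ∧
      K 8 = 943 / (168 * Real.pi ^ 2) - 1535 / (3 * Real.pi ^ 4) + 10080 / Real.pi ^ 6
        - 54912 / Real.pi ^ 8) := by
  refine ⟨⟨_, _, MAPersistence.isNormalizedExpansion_eigPoly⟩,
    fun K g h => h.exists_polynomial, MAPersistence.isNormalizedExpansion_iff, fun K g h => ?_⟩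
  rw [h.eigCoeff_eq]
  exact MAPersistence.eigCoeff_values
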